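/- Let $M$ be a smooth manifold with a hypercomplex structure $(I,J,K)$, i.e. three smooth integrable almost complex structures with $IJ=-JI=K$, and let $S^2=\{aI+bJ+cK : a^2+b^2+c^2=1\}$. An endomorphism $A$ of $TM$ acts on $k$-forms by $(A\alpha)(X_1,\dots,X_k)=\alpha(AX_1,\dots,AX_k)$. For $\mathcal I\in S^2$ let $\Lambda^{p,q}_{\mathcal I}$ be the bundle of complex-valued forms of type $(p,q)$ with respect to $\mathcal I$, and put $$A^k=\sum_{\mathcal I\in S^2}\bigl(\Lambda^{k,0}_{\mathcal I}\oplus\Lambda^{0,k}_{\mathcal I}\bigr),\qquad B^k=\bigcap_{\mathcal I\in S^2}\bigl(\Lambda^{k-1,1}_{\mathcal I}\oplus\Lambda^{k-2,2}_{\mathcal I}\oplus\dots\oplus\Lambda^{1,k-1}_{\mathcal I}\bigr).$$ Then $\Lambda^k\otimes\mathbb C=A^k\oplus B^k$. Let $\eta:\Lambda^k\otimes\mathbb C\to A^k$ be the projection with kernel $B^k$ and let $D=\eta\circ d$ be the Salamon differential. Let $F$ be a non-degenerate Salamon $(1,1)$-form, i.e. a smooth real $2$-form, non-degenerate at every point,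 with $IF=F$ and $JF=-F$. Then $g=-F(I\cdot,\cdot)$ is a smooth, possibly indefinite, hyperhermitian metric, and with $F_I=g(I\cdot,\cdot)=F$, $F_J=g(J\cdot,\cdot)$, $F_K=g(K\cdot,\cdot)$ the following are equivalent: 1. $g$ is HKT, that is, $I\,dF_I=J\,dF_J=K\,dF_K$; 2. $F$ is $D$-closed, that is, $DF=0$. -/

import Mathlib

open scoped Manifold ContDiff

/-- Three complex structures `I`, `J`, `K` with `IJ = -JI = K` on a real vector space. -/
structure QuaternionicStructure (V : Type*) [AddCommGroup V] [Module ℝ V] where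
  I : Module.End ℝ V
  J : Module.End ℝ V
  K : Module.End ℝ V
  I_sq : I * I = -1
  J_sq : J * J = -1
  K_sq : K * K = -1
  I_mul_J : I * J = K
  J_mul_I : J * I = -K

/-- The complex-valued `k`-forms of type `(p, q)` with respect to the complex structure `A`, where
`p + q = k`. The derivation `v ↦ ∑ j, α (v₁, …, A vⱼ, …, vₖ)` induced by `A` acts on a wedge product
of `p` forms of type `(1, 0)` (those with `θ ∘ A = i θ`) and `q` forms of type `(0, 1)` (those with
`θ ∘ A = -i θ`) as multiplication by `i (p - q)`; these numbers are distinct for distinct types of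
the same degree, and `Λ^{p,q}` is the corresponding eigenspace. -/
def typeForms {V : Type*} [AddCommGroup V] [Module ℝ V] {k : ℕ} (A : Module.End ℝ V) (p q : ℕ) :
    Submodule ℂ (V [⋀^Fin k]→ₗ[ℝ] ℂ) where
  carrier := {α | ∀ v : Fin k → V,
    ∑ j, α (Function.update v j (A (v j))) = Complex.I * ((p : ℂ) - (q : ℂ)) * α v}
  add_mem' := by
    intro α β hα hβ v
    simp only [AlternatingMap.add_apply, Finset.sum_add_distrib, hα v, hβ v, mul_add]
  zero_mem' := by intro v; simp
  smul_mem' := by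
    intro c α hα v
    simp only [AlternatingMap.smul_apply, smul_eq_mul, ← Finset.mul_sum, hα v]
    ring

namespace QuaternionicStructure

variable {V : Type*} [AddCommGroup V] [Module ℝ V] (Q : QuaternionicStructure V)

/-- The sphere `S² = {aI + bJ + cK : a² + b² + c² = 1}` of complex structures. -/
def sphere : Set (Module.End ℝ V) :=
  {A | ∃ a b c : ℝ, a ^ 2 + b ^ 2 + c ^ 2 = 1 ∧ A = a • Q.I + b • Q.J + c • Q.K}

/-- Salamon's space `A^k`: the sum over all `A ∈ S²` of `Λ^{k,0}_A ⊕ Λ^{0,k}_A`. -/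
noncomputable def extremeForms (k : ℕ) : Submodule ℂ (V [⋀^Fin k]→ₗ[ℝ] ℂ) :=
  ⨆ A ∈ Q.sphere, (typeForms A k 0 ⊔ typeForms A 0 k)

/-- The space `B^k`: the intersection over all `A ∈ S²` of
`Λ^{k-1,1}_A ⊕ Λ^{k-2,2}_A ⊕ ⋯ ⊕ Λ^{1,k-1}_A`. -/
noncomputable def middleForms (k : ℕ) : Submodule ℂ (V [⋀^Fin k]→ₗ[ℝ] ℂ) :=
  ⨅ A ∈ Q.sphere, ⨆ (p : ℕ) (q : ℕ) (_ : 0 < p ∧ 0 < q ∧ p + q = k), typeForms A p q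

theorem I_mul_K : Q.I * Q.K = -Q.J := by
  rw [← Q.I_mul_J, ← mul_assoc, Q.I_sq, neg_one_mul]
theorem K_mul_I : Q.K * Q.I = Q.J := by
  have : Q.K = -(Q.J * Q.I) := by rw [Q.J_mul_I, neg_neg]
  rw [this, neg_mul, mul_assoc, Q.I_sq, mul_neg_one, neg_neg]
theorem K_mul_J : Q.K * Q.J = -Q.I := by
  rw [← Q.I_mul_J, mul_assoc, Q.J_sq, mul_neg_one]
theorem J_mul_K : Q.J * Q.K = Q.I := by
  have : Q.K = -(Q.J * Q.I) := by rw [Q.J_mul_I, neg_neg]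
  rw [this, mul_neg, ← mul_assoc, Q.J_sq, neg_one_mul, neg_neg]

theorem sphere_sq {A : Module.End ℝ V} (hA : A ∈ Q.sphere) : A * A = -1 := by
  obtain ⟨a, b, c, h, rfl⟩ := hA
  simp only [add_mul, mul_add, smul_mul_assoc, mul_smul_comm, Q.I_sq, Q.J_sq, Q.K_sq, Q.I_mul_J,
    Q.J_mul_I, Q.I_mul_K, Q.K_mul_I, Q.J_mul_K, Q.K_mul_J]
  conv_rhs => rw [← one_smul ℝ (-1 : Module.End ℝ V), ← h]
  module

/-- There is a basis in which every element of the sphere has a skew-symmetric matrix. -/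
theorem exists_skew_basis [FiniteDimensional ℝ V] :
    ∃ (n : ℕ) (e : Module.Basis (Fin n) ℝ V), ∀ A ∈ Q.sphere, ∀ b c : Fin n,
      e.repr (A (e c)) b = -e.repr (A (e b)) c := by
  classical
  let e0 := Module.finBasis ℝ V
  let h : V → V → ℝ := fun v w => ∑ i, e0.repr v i * e0.repr w i
  have hadd : ∀ u v w, h (u + v) w = h u w + h v w := fun u v w => by
    simp [h, add_mul, Finset.sum_add_distrib]
  have hsmul : ∀ (r : ℝ) v w, h (r • v) w = r * h v w := fun r v w => by
    simp [h, Finset.mul_sum, mul_assoc]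
  have hsymm : ∀ v w, h v w = h w v := fun v w => by simp [h, mul_comm]
  have hneg : ∀ v w, h (-v) w = - h v w := fun v w => by
    simpa using hsmul (-1) v w
  have hneg' : ∀ v w, h v (-w) = - h v w := fun v w => by rw [hsymm, hneg, hsymm]
  have hpos : ∀ v, 0 ≤ h v v := fun v => Finset.sum_nonneg fun i _ => mul_self_nonneg _
  have hdef : ∀ v, h v v = 0 → v = 0 := fun v hv => by
    rw [Finset.sum_eq_zero_iff_of_nonneg (fun i _ => mul_self_nonneg _)] at hv
    apply e0.ext_elem
    intro i
    simpa using hv i (Finset.mem_univ i)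
  let c : InnerProductSpace.Core ℝ V :=
    { inner := fun v w => h v w + h (Q.I v) (Q.I w) + h (Q.J v) (Q.J w) + h (Q.K v) (Q.K w)
      conj_inner_symm := fun v w => by
        simp only [starRingEnd_apply, star_trivial]
        rw [hsymm w v, hsymm (Q.I w), hsymm (Q.J w), hsymm (Q.K w)]
      re_inner_nonneg := fun v => by
        simp only [RCLike.re_to_real]
        have := hpos v; have := hpos (Q.I v); have := hpos (Q.J v); have := hpos (Q.K v)
        positivity
      add_left := fun u v w => by simp only [map_add, hadd]; ring
      smul_left := fun v w r => by
        simp only [map_smul, hsmul, starRingEnd_apply, star_trivial]; ring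
      definite := fun v hv => by
        have h1 := hpos v; have h2 := hpos (Q.I v); have h3 := hpos (Q.J v); have h4 := hpos (Q.K v)
        exact hdef v (by linarith) }
  have hI : ∀ v w, c.inner (Q.I v) w = - c.inner v (Q.I w) := fun v w => by
    have e1 : ∀ u, Q.I (Q.I u) = -u := fun u => by simpa using congrArg (· u) Q.I_sq
    have e2 : ∀ u, Q.J (Q.I u) = -Q.K u := fun u => by simpa using congrArg (· u) Q.J_mul_I
    have e3 : ∀ u, Q.K (Q.I u) = Q.J u := fun u => by simpa using congrArg (· u) Q.K_mul_I
    simp only [c, Inner.inner, e1, e2, e3, hneg, hneg']; ring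
  have hJ : ∀ v w, c.inner (Q.J v) w = - c.inner v (Q.J w) := fun v w => by
    have e1 : ∀ u, Q.J (Q.J u) = -u := fun u => by simpa using congrArg (· u) Q.J_sq
    have e2 : ∀ u, Q.I (Q.J u) = Q.K u := fun u => by simpa using congrArg (· u) Q.I_mul_J
    have e3 : ∀ u, Q.K (Q.J u) = -Q.I u := fun u => by simpa using congrArg (· u) Q.K_mul_J
    simp only [c, Inner.inner, e1, e2, e3, hneg, hneg']; ring
  have hK : ∀ v w, c.inner (Q.K v) w = - c.inner v (Q.K w) := fun v w => by
    have e1 : ∀ u, Q.K (Q.K u) = -u := fun u => by simpa using congrArg (· u) Q.K_sq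
    have e2 : ∀ u, Q.I (Q.K u) = -Q.J u := fun u => by simpa using congrArg (· u) Q.I_mul_K
    have e3 : ∀ u, Q.J (Q.K u) = Q.I u := fun u => by simpa using congrArg (· u) Q.J_mul_K
    simp only [c, Inner.inner, e1, e2, e3, hneg, hneg']; ring
  let _ : NormedAddCommGroup V := c.toNormedAddCommGroup
  let _ : InnerProductSpace ℝ V := InnerProductSpace.ofCore c.toCore
  have hI' : ∀ v w : V, inner ℝ (Q.I v) w = - inner ℝ v (Q.I w) := hI
  have hJ' : ∀ v w : V, inner ℝ (Q.J v) w = - inner ℝ v (Q.J w) := hJ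
  have hK' : ∀ v w : V, inner ℝ (Q.K v) w = - inner ℝ v (Q.K w) := hK
  let e := stdOrthonormalBasis ℝ V
  refine ⟨_, e.toBasis, ?_⟩
  rintro A ⟨x, y, z, -, rfl⟩ b d
  have hA : ∀ v w : V, inner ℝ ((x • Q.I + y • Q.J + z • Q.K) v) w =
      - inner ℝ v ((x • Q.I + y • Q.J + z • Q.K) w) := fun v w => by
    simp only [LinearMap.add_apply, LinearMap.smul_apply, inner_add_left, inner_add_right,
      real_inner_smul_left, real_inner_smul_right, hI', hJ', hK']
    ring
  simp only [OrthonormalBasis.coe_toBasis, OrthonormalBasis.coe_toBasis_repr_apply,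
    OrthonormalBasis.repr_apply_apply]
  rw [real_inner_comm _ (e d), hA, neg_neg]

end QuaternionicStructure

/-- Given finitely many commuting operators with square `-1`, every vector is a sum of eigenvectors
of their sum with eigenvalues `i (p - q)`, where `p + q` is the number of operators. -/
theorem mem_iSup_weight {W ι : Type*} [AddCommGroup W] [Module ℂ W] [DecidableEq ι]
    (T : ι → Module.End ℂ W) (hT : ∀ i, T i * T i = -1) (hc : ∀ i j, T i * T j = T j * T i)
    (s : Finset ι) (P : W → Prop) (hadd : ∀ x y, P x → P y → P (x + y))
    (hP : ∀ (x : W) (p q : ℕ), p + q = s.card →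
      ∑ i ∈ s, T i x = (Complex.I * ((p : ℂ) - (q : ℂ))) • x → P x) (x : W) : P x := by
  induction s using Finset.induction_on generalizing x P with
  | empty => exact hP x 0 0 rfl (by simp)
  | insert a s ha ih =>
    refine ih P hadd (fun y p q hpq hy => ?_) x
    have hTT : ∀ z, T a (T a z) = -z := fun z => by simpa using congrArg (· z) (hT a)
    have hcc : ∀ i z, T i (T a z) = T a (T i z) := fun i z => by
      simpa using congrArg (· z) (hc i a)
    have key : y = (1 / 2 : ℂ) • (y - Complex.I • T a y) + (1 / 2 : ℂ) • (y + Complex.I • T a y) := by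
      module
    have hs : ∑ i ∈ s, T i (T a y) = (Complex.I * ((p : ℂ) - (q : ℂ))) • T a y := by
      simp only [hcc]
      rw [← map_sum, hy, map_smul]
    rw [key]
    refine hadd _ _ (hP _ (p + 1) q ?_ ?_) (hP _ p (q + 1) ?_ ?_)
    · rw [Finset.card_insert_of_notMem ha]; omega
    · rw [Finset.sum_insert ha]
      simp only [map_smul, map_sub, hTT, ← Finset.smul_sum, Finset.sum_sub_distrib, hs, hy]
      push_cast
      match_scalars <;> ring_nf <;> simp <;> norm_num
    · rw [Finset.card_insert_of_notMem ha]; omega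
    · rw [Finset.sum_insert ha]
      simp only [map_smul, map_add, hTT, ← Finset.smul_sum, Finset.sum_add_distrib, hs, hy]
      push_cast
      match_scalars <;> ring_nf <;> simp <;> norm_num

section
variable {V : Type*} [AddCommGroup V] [Module ℝ V] {k : ℕ}

/-- Precomposition of the `j`-th argument of a multilinear map with `A`. -/
noncomputable def slotAct (A : Module.End ℝ V) (j : Fin k) :
    Module.End ℂ (MultilinearMap ℝ (fun _ : Fin k => V) ℂ) where
  toFun m := m.compLinearMap (Function.update (fun _ => LinearMap.id) j A)
  map_add' _ _ := rfl
  map_smul' _ _ := rfl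

theorem slotAct_apply (A : Module.End ℝ V) (j : Fin k)
    (m : MultilinearMap ℝ (fun _ : Fin k => V) ℂ) (v : Fin k → V) :
    slotAct A j m v = m (Function.update v j (A (v j))) := by
  change m _ = m _
  congr 1
  funext i
  by_cases h : i = j
  · subst h; simp
  · simp [h]

/-- The forms of the various types span the space of all forms. -/
theorem typeForms_induction {A : Module.End ℝ V} (hA : A * A = -1)
    (S : Submodule ℂ (V [⋀^Fin k]→ₗ[ℝ] ℂ))
    (hS : ∀ p q, p + q = k → typeForms A p q ≤ S) : S = ⊤ := by
  classical
  rw [eq_top_iff]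
  rintro α -
  have hAA : ∀ z, A (A z) = -z := fun z => by simpa using congrArg (· z) hA
  have main := mem_iSup_weight (fun j : Fin k => slotAct A j) (fun i => by
      ext m v
      simp only [Module.End.mul_apply, slotAct_apply]
      simp only [Function.update_self, Function.update_idem, hAA]
      rw [← neg_one_smul ℝ, MultilinearMap.map_update_smul]
      simp) (fun i j => by
      ext m v
      simp only [Module.End.mul_apply, slotAct_apply]
      by_cases h : i = j
      · subst h; rfl
      · rw [Function.update_of_ne h, Function.update_of_ne (Ne.symm h), Function.update_comm h])
    Finset.univ (fun m => MultilinearMap.alternatization m ∈ S)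
    (fun x y hx hy => by rw [map_add]; exact S.add_mem hx hy)
    (fun m p q hpq hm => by
      refine hS p q (by simpa using hpq) ?_
      intro v
      have hm' : ∀ w : Fin k → V, ∑ j, m (Function.update w j (A (w j))) =
          Complex.I * ((p : ℂ) - (q : ℂ)) * m w := fun w => by
        have := congrArg (fun f : MultilinearMap ℝ (fun _ : Fin k => V) ℂ => f w) hm
        simpa [slotAct_apply] using this
      simp only [MultilinearMap.alternatization_apply, MultilinearMap.domDomCongr_apply]
      rw [Finset.sum_comm, Finset.mul_sum]
      refine Finset.sum_congr rfl fun σ _ => ?_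
      rw [← Finset.smul_sum, mul_smul_comm, ← hm']
      congr 1
      refine (Equiv.sum_comp σ _).symm.trans (Finset.sum_congr rfl fun j _ => ?_)
      congr 1
      funext i
      by_cases h : i = j
      · subst h; simp
      · simp [h])
    α.toMultilinearMap
  have h2 : MultilinearMap.alternatization α.toMultilinearMap = (k.factorial : ℂ) • α := by
    have := AlternatingMap.coe_alternatization α
    rw [Fintype.card_fin] at this
    rw [this, Nat.cast_smul_eq_nsmul]
  rw [h2] at main
  have hk : (k.factorial : ℂ) ≠ 0 := by exact_mod_cast k.factorial_ne_zero
  have := S.smul_mem (k.factorial : ℂ)⁻¹ main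
  rwa [smul_smul, inv_mul_cancel₀ hk, one_smul] at this

/-- The derivation induced by a skew `A` is skew for the induced Hermitian product on forms. -/
theorem sum_skew {n : ℕ} (e : Module.Basis (Fin n) ℝ V) {A : Module.End ℝ V}
    (hA : ∀ b c : Fin n, e.repr (A (e c)) b = -e.repr (A (e b)) c)
    (α β : V [⋀^Fin k]→ₗ[ℝ] ℂ) :
    ∑ i : Fin k → Fin n, (starRingEnd ℂ)
        (∑ j, α (Function.update (e ∘ i) j (A ((e ∘ i) j)))) * β (e ∘ i) =
      -∑ i : Fin k → Fin n, (starRingEnd ℂ) (α (e ∘ i)) *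
        ∑ j, β (Function.update (e ∘ i) j (A ((e ∘ i) j))) := by
  classical
  have expand : ∀ (γ : V [⋀^Fin k]→ₗ[ℝ] ℂ) (i : Fin k → Fin n) (j : Fin k),
      γ (Function.update (e ∘ i) j (A ((e ∘ i) j))) =
        ∑ b, (e.repr (A (e (i j))) b : ℂ) * γ (e ∘ Function.update i j b) := fun γ i j => by
    conv_lhs => rw [Function.comp_apply, ← e.sum_repr (A (e (i j)))]
    rw [AlternatingMap.map_update_sum]
    refine Finset.sum_congr rfl fun b _ => ?_
    rw [AlternatingMap.map_update_smul, Complex.real_smul, Function.comp_update]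
  simp only [expand, map_sum, map_mul, Complex.conj_ofReal, Finset.sum_mul, Finset.mul_sum]
  rw [Finset.sum_comm]
  conv_rhs => rw [Finset.sum_comm]
  rw [← Finset.sum_neg_distrib]
  refine Finset.sum_congr rfl fun j _ => ?_
  rw [← Finset.sum_product', ← Finset.sum_product', ← Finset.sum_neg_distrib]
  refine Finset.sum_nbij' (fun x => (Function.update x.1 j x.2, x.1 j))
    (fun x => (Function.update x.1 j x.2, x.1 j)) ?_ ?_ ?_ ?_ ?_
  · simp
  · simp
  · simp
  · simp
  · rintro ⟨i, b⟩ -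
    simp only [Function.update_self, Function.update_idem, Function.update_eq_self]
    rw [hA b (i j)]
    push_cast
    ring

end

namespace QuaternionicStructure
variable {V : Type*} [AddCommGroup V] [Module ℝ V] (Q : QuaternionicStructure V)

/-- `Λ^k = A^k ⊕ B^k`; the sum is orthogonal for the Hermitian product induced by any
hyperhermitian inner product on `V`. -/
theorem isCompl_extremeForms_middleForms [FiniteDimensional ℝ V] (k : ℕ) :
    IsCompl (Q.extremeForms k) (Q.middleForms k) := by
  obtain ⟨n, e, he⟩ := Q.exists_skew_basis
  let c : InnerProductSpace.Core ℂ (V [⋀^Fin k]→ₗ[ℝ] ℂ) :=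
    { inner := fun α β => ∑ i : Fin k → Fin n, (starRingEnd ℂ) (α (e ∘ i)) * β (e ∘ i)
      conj_inner_symm := fun α β => by simp [mul_comm]
      re_inner_nonneg := fun α => by
        rw [map_sum]
        refine Finset.sum_nonneg fun i _ => ?_
        rw [mul_comm, Complex.mul_conj]
        exact Complex.normSq_nonneg _
      add_left := fun α β γ => by simp [add_mul, Finset.sum_add_distrib]
      smul_left := fun α β r => by simp [Finset.mul_sum, mul_assoc]
      definite := fun α h => by
        have h' : ∑ i : Fin k → Fin n, Complex.normSq (α (e ∘ i)) = 0 := by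
          have h2 : ((∑ i : Fin k → Fin n, Complex.normSq (α (e ∘ i)) : ℝ) : ℂ) = 0 := by
            rw [← h]
            push_cast
            refine Finset.sum_congr rfl fun i _ => ?_
            rw [mul_comm, Complex.mul_conj]
          exact_mod_cast h2
        rw [Finset.sum_eq_zero_iff_of_nonneg (fun i _ => Complex.normSq_nonneg _)] at h'
        refine e.ext_alternating fun i _ => ?_
        simpa [Function.comp_def] using h' i (Finset.mem_univ i) }
  let _ : NormedAddCommGroup (V [⋀^Fin k]→ₗ[ℝ] ℂ) := c.toNormedAddCommGroup
  let _ : InnerProductSpace ℂ (V [⋀^Fin k]→ₗ[ℝ] ℂ) := InnerProductSpace.ofCore c.toCore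
  have hfin : FiniteDimensional ℂ (V [⋀^Fin k]→ₗ[ℝ] ℂ) := by
    let f : (V [⋀^Fin k]→ₗ[ℝ] ℂ) →ₗ[ℂ] ((Fin k → Fin n) → ℂ) :=
      { toFun := fun α i => α (e ∘ i)
        map_add' := fun _ _ => rfl
        map_smul' := fun _ _ => rfl }
    refine FiniteDimensional.of_injective f fun α β h => e.ext_alternating fun i _ => ?_
    exact congrFun h i
  have hort : ∀ A ∈ Q.sphere, ∀ p q p' q' : ℕ, p + q = k → p' + q' = k → p ≠ p' →
      (typeForms A p q : Submodule ℂ (V [⋀^Fin k]→ₗ[ℝ] ℂ)) ≤ (typeForms A p' q')ᗮ := by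
    intro A hA p q p' q' hpq hpq' hne β hβ
    rw [Submodule.mem_orthogonal]
    intro α hα
    have key := sum_skew e (he A hA) α β
    simp only [hα (e ∘ _), hβ (e ∘ _)] at key
    change ∑ i : Fin k → Fin n, (starRingEnd ℂ) (α (e ∘ i)) * β (e ∘ i) = 0
    have k1 : ∑ i : Fin k → Fin n, (starRingEnd ℂ) (Complex.I * ((p' : ℂ) - q') * α (e ∘ i)) *
        β (e ∘ i) = -(Complex.I * ((p' : ℂ) - q')) *
          ∑ i : Fin k → Fin n, (starRingEnd ℂ) (α (e ∘ i)) * β (e ∘ i) := by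
      rw [Finset.mul_sum]
      refine Finset.sum_congr rfl fun i _ => ?_
      simp
      ring
    have k2 : ∑ i : Fin k → Fin n, (starRingEnd ℂ) (α (e ∘ i)) *
        (Complex.I * ((p : ℂ) - q) * β (e ∘ i)) = (Complex.I * ((p : ℂ) - q)) *
          ∑ i : Fin k → Fin n, (starRingEnd ℂ) (α (e ∘ i)) * β (e ∘ i) := by
      rw [Finset.mul_sum]
      refine Finset.sum_congr rfl fun i _ => ?_
      ring
    rw [k1, k2] at key
    have h3 : (2 * Complex.I * ((p' : ℂ) - p)) *
        ∑ i : Fin k → Fin n, (starRingEnd ℂ) (α (e ∘ i)) * β (e ∘ i) = 0 := by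
      have e1 : (q : ℂ) = k - p := by rw [← hpq]; push_cast; ring
      have e2 : (q' : ℂ) = k - p' := by rw [← hpq']; push_cast; ring
      rw [e1, e2] at key
      linear_combination -key
    refine (mul_eq_zero.mp h3).resolve_left ?_
    have : ((p' : ℂ) - p) ≠ 0 := sub_ne_zero.mpr (by exact_mod_cast hne.symm)
    simp [this]
  have hmid : ∀ A ∈ Q.sphere,
      (⨆ (p : ℕ) (q : ℕ) (_ : 0 < p ∧ 0 < q ∧ p + q = k), typeForms A p q) =
        (typeForms A k 0 ⊔ typeForms A 0 k : Submodule ℂ (V [⋀^Fin k]→ₗ[ℝ] ℂ))ᗮ := by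
    intro A hA
    set M : Submodule ℂ (V [⋀^Fin k]→ₗ[ℝ] ℂ) :=
      ⨆ (p : ℕ) (q : ℕ) (_ : 0 < p ∧ 0 < q ∧ p + q = k), typeForms A p q with hM
    set S : Submodule ℂ (V [⋀^Fin k]→ₗ[ℝ] ℂ) := typeForms A k 0 ⊔ typeForms A 0 k with hSdef
    have hle : M ≤ Sᗮ := by
      rw [hM, hSdef]
      refine iSup_le fun p => iSup_le fun q => iSup_le fun ⟨hp, hq, hpq⟩ => ?_
      rw [← Submodule.inf_orthogonal]
      exact le_inf (hort A hA p q k 0 hpq (by omega) (by omega))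
        (hort A hA p q 0 k hpq (by omega) (by omega))
    have htop : M ⊔ S = ⊤ := by
      refine typeForms_induction (Q.sphere_sq hA) _ fun p q hpq => ?_
      rcases Nat.eq_zero_or_pos p with hp | hp
      · subst hp
        obtain rfl : q = k := by omega
        exact le_sup_of_le_right le_sup_right
      rcases Nat.eq_zero_or_pos q with hq | hq
      · subst hq
        obtain rfl : p = k := by omega
        exact le_sup_of_le_right le_sup_left
      refine le_sup_of_le_left ?_
      rw [hM]
      exact le_iSup_of_le p (le_iSup_of_le q (le_iSup_of_le ⟨hp, hq, hpq⟩ le_rfl))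
    refine le_antisymm hle ?_
    calc Sᗮ = (M ⊔ S) ⊓ Sᗮ := by rw [htop, top_inf_eq]
      _ = M ⊔ S ⊓ Sᗮ := (sup_inf_assoc_of_le S hle)
      _ = M := by rw [Submodule.inf_orthogonal_eq_bot, sup_bot_eq]
      _ ≤ M := le_rfl
  have : Q.middleForms k = (Q.extremeForms k)ᗮ := by
    rw [middleForms, extremeForms, ← Submodule.iInf_orthogonal]
    refine iInf_congr fun A => ?_
    by_cases hA : A ∈ Q.sphere
    · simpa only [hA, iInf_pos, iSup_pos] using hmid A hA
    · simp [hA]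
  rw [this]
  exact Submodule.isCompl_orthogonal _

/-- The projection `Λ^k → A^k` with kernel `B^k`. -/
noncomputable def salamonProj [FiniteDimensional ℝ V] (k : ℕ) :
    (V [⋀^Fin k]→ₗ[ℝ] ℂ) →ₗ[ℂ] Q.extremeForms k :=
  Submodule.projectionOnto _ _ (Q.isCompl_extremeForms_middleForms k)

end QuaternionicStructure

section
variable {E : Type*} [NormedAddCommGroup E] [NormedSpace ℝ E]

/-- An alternating 2-form as a bilinear form. -/
noncomputable def altToBilin : (E [⋀^Fin 2]→L[ℝ] ℝ) →L[ℝ] (E →L[ℝ] E →L[ℝ] ℝ) :=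
  (ContinuousLinearMap.compL ℝ E (E [⋀^Fin 1]→L[ℝ] ℝ) (E →L[ℝ] ℝ)
    ((ContinuousAlternatingMap.ofSubsingletonLIE (𝕜 := ℝ) (E := E) (F := ℝ) (0 : Fin 1)).symm.toContinuousLinearEquiv :
      (E [⋀^Fin 1]→L[ℝ] ℝ) →L[ℝ] (E →L[ℝ] ℝ))).comp
  (ContinuousAlternatingMap.curryLeftLI (𝕜 := ℝ) (E := E) (F := ℝ) (n := 1)).toContinuousLinearMap

theorem altToBilin_apply (f : E [⋀^Fin 2]→L[ℝ] ℝ) (v w : E) : altToBilin f v w = f ![v, w] := by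
  change f (Matrix.vecCons v (fun _ => w)) = _
  congr 1
  funext i
  fin_cases i <;> rfl

theorem contDiff_altToBilin {n : ℕ∞ω} :
    ContDiff ℝ n (fun f : E [⋀^Fin 2]→L[ℝ] ℝ => altToBilin f) := by
  fun_prop

theorem alternating_neg_left (f : E [⋀^Fin 2]→L[ℝ] ℝ) (v w : E) : f ![-v, w] = -f ![v, w] := by
  rw [← altToBilin_apply, ← altToBilin_apply, map_neg, neg_apply]

/-- A bilinear form that vanishes on the diagonal as an alternating 2-form. -/
noncomputable def bilinToAlt (b : E →L[ℝ] E →L[ℝ] ℝ) (h : ∀ v, b v v = 0) : E [⋀^Fin 2]→L[ℝ] ℝ where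
  toFun v := b (v 0) (v 1)
  map_update_add' := by
    intro _ v i x y
    fin_cases i <;> simp
  map_update_smul' := by
    intro _ v i c x
    fin_cases i <;> simp
  map_eq_zero_of_eq' := by
    intro v i j hv hij
    have : v 0 = v 1 := by
      fin_cases i <;> fin_cases j <;> simp_all
    simp [this, h]
  cont := by fun_prop
end

section
variable {E : Type*} [NormedAddCommGroup E] [NormedSpace ℝ E] {M : Type*} [TopologicalSpace M]
  [ChartedSpace E M]

/-- The pullback of a `k`-form on `M` by the inverse of the chart at `x₀`. -/
noncomputable def formInChart {F : Type*} [NormedAddCommGroup F] [NormedSpace ℝ F] {k : ℕ}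
    (α : ∀ x : M, TangentSpace 𝓘(ℝ, E) x [⋀^Fin k]→L[ℝ] F) (x₀ : M) (y : E) :
    E [⋀^Fin k]→L[ℝ] F :=
  (α ((extChartAt 𝓘(ℝ, E) x₀).symm y)).compContinuousLinearMap
    (mfderiv 𝓘(ℝ, E) 𝓘(ℝ, E) (extChartAt 𝓘(ℝ, E) x₀).symm y)

/-- The exterior derivative of a `k`-form on `M`; at `x` it is computed in the chart at `x`. -/
noncomputable def mextDeriv {F : Type*} [NormedAddCommGroup F] [NormedSpace ℝ F] {k : ℕ}
    (α : ∀ x : M, TangentSpace 𝓘(ℝ, E) x [⋀^Fin k]→L[ℝ] F) (x : M) :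
    TangentSpace 𝓘(ℝ, E) x [⋀^Fin (k + 1)]→L[ℝ] F :=
  (extDeriv (formInChart α x) (extChartAt 𝓘(ℝ, E) x x)).compContinuousLinearMap
    (mfderiv 𝓘(ℝ, E) 𝓘(ℝ, E) (extChartAt 𝓘(ℝ, E) x) x)

variable [IsManifold 𝓘(ℝ, E) ∞ M]

/-- The vector field `X` is smooth at `x`. -/
def IsSmoothField (X : ∀ x : M, TangentSpace 𝓘(ℝ, E) x) (x : M) : Prop :=
  ContMDiffAt 𝓘(ℝ, E) (𝓘(ℝ, E).prod 𝓘(ℝ, E)) ∞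
    (fun y => (Bundle.TotalSpace.mk' E y (X y) : TangentBundle 𝓘(ℝ, E) M)) x

/-- Integrability of an almost complex structure `A`: its Nijenhuis tensor
`[AX, AY] - A[AX, Y] - A[X, AY] - [X, Y]` vanishes. -/
def IsIntegrableACS (A : ∀ x : M, TangentSpace 𝓘(ℝ, E) x →L[ℝ] TangentSpace 𝓘(ℝ, E) x) : Prop :=
  ∀ (x : M) (X Y : ∀ y : M, TangentSpace 𝓘(ℝ, E) y), IsSmoothField X x → IsSmoothField Y x →
    VectorField.mlieBracket 𝓘(ℝ, E) (fun y => A y (X y)) (fun y => A y (Y y)) x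
      - A x (VectorField.mlieBracket 𝓘(ℝ, E) (fun y => A y (X y)) Y x)
      - A x (VectorField.mlieBracket 𝓘(ℝ, E) X (fun y => A y (Y y)) x)
      - VectorField.mlieBracket 𝓘(ℝ, E) X Y x = 0

/-- `A` is a smooth section of `End(TM)`. -/
def IsSmoothEnd (A : ∀ x : M, TangentSpace 𝓘(ℝ, E) x →L[ℝ] TangentSpace 𝓘(ℝ, E) x) : Prop :=
  ContMDiff 𝓘(ℝ, E) (𝓘(ℝ, E).prod 𝓘(ℝ, E →L[ℝ] E)) ∞
    (fun x => Bundle.TotalSpace.mk' (E →L[ℝ] E)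
      (E := fun x : M => TangentSpace 𝓘(ℝ, E) x →L[ℝ] TangentSpace 𝓘(ℝ, E) x) x (A x))

/-- `g` is a smooth section of `T*M ⊗ T*M`. -/
def IsSmoothBilin (g : ∀ x : M, TangentSpace 𝓘(ℝ, E) x →L[ℝ] TangentSpace 𝓘(ℝ, E) x →L[ℝ] ℝ) :
    Prop :=
  ContMDiff 𝓘(ℝ, E) (𝓘(ℝ, E).prod 𝓘(ℝ, E →L[ℝ] E →L[ℝ] ℝ)) ∞
    (fun x => Bundle.TotalSpace.mk' (E →L[ℝ] E →L[ℝ] ℝ)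
      (E := fun x : M => TangentSpace 𝓘(ℝ, E) x →L[ℝ] TangentSpace 𝓘(ℝ, E) x →L[ℝ] ℝ) x (g x))

/-- `α` is a smooth section of the bundle of alternating `k`-forms on `M` with values in `F`. -/
def IsSmoothForm {F : Type*} [NormedAddCommGroup F] [NormedSpace ℝ F] {k : ℕ}
    (α : ∀ x : M, TangentSpace 𝓘(ℝ, E) x [⋀^Fin k]→L[ℝ] F) : Prop :=
  ContMDiff 𝓘(ℝ, E) (𝓘(ℝ, E).prod 𝓘(ℝ, E [⋀^Fin k]→L[ℝ] F)) ∞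
    (fun x => Bundle.TotalSpace.mk' (E [⋀^Fin k]→L[ℝ] F)
      (E := fun x : M => TangentSpace 𝓘(ℝ, E) x [⋀^Fin k]→L[ℝ] Bundle.Trivial M F x) x (α x))

theorem contMDiffAt_altToBilin_comp {f : M → E [⋀^Fin 2]→L[ℝ] ℝ} {B : M → E →L[ℝ] E} {x₀ : M}
    (hf : ContMDiffAt 𝓘(ℝ, E) 𝓘(ℝ, E [⋀^Fin 2]→L[ℝ] ℝ) ∞ f x₀)
    (hB : ContMDiffAt 𝓘(ℝ, E) 𝓘(ℝ, E →L[ℝ] E) ∞ B x₀) :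
    ContMDiffAt 𝓘(ℝ, E) 𝓘(ℝ, E →L[ℝ] E →L[ℝ] ℝ) ∞
      (fun x => (altToBilin (f x)).comp (-B x)) x₀ := by
  have h1 : ContMDiffAt 𝓘(ℝ, E) 𝓘(ℝ, E →L[ℝ] E →L[ℝ] ℝ) ∞ (fun x => altToBilin (f x)) x₀ :=
    contDiff_altToBilin.contMDiff.contMDiffAt.comp x₀ hf
  have h2 : ContMDiffAt 𝓘(ℝ, E) 𝓘(ℝ, E →L[ℝ] E) ∞ (fun x => -B x) x₀ :=
    (contDiff_neg (𝕜 := ℝ) (F := E →L[ℝ] E)).contMDiff.contMDiffAt.comp x₀ hB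
  exact h1.clm_comp h2

theorem isSmoothBilin_of_form (α : ∀ x : M, TangentSpace 𝓘(ℝ, E) x [⋀^Fin 2]→L[ℝ] ℝ)
    (A : ∀ x : M, TangentSpace 𝓘(ℝ, E) x →L[ℝ] TangentSpace 𝓘(ℝ, E) x)
    (hα : IsSmoothForm α) (hA : IsSmoothEnd A)
    (g : ∀ x : M, TangentSpace 𝓘(ℝ, E) x →L[ℝ] TangentSpace 𝓘(ℝ, E) x →L[ℝ] ℝ)
    (hg : ∀ x v w, g x v w = -α x ![A x v, w]) : IsSmoothBilin g := by
  intro x₀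
  have h1 := (Bundle.contMDiffAt_section x₀).1 (hα x₀)
  have h2 := (Bundle.contMDiffAt_section x₀).1 (hA x₀)
  refine (Bundle.contMDiffAt_section x₀).2 ?_
  have h3 : ContMDiffAt 𝓘(ℝ, E) 𝓘(ℝ, E →L[ℝ] E →L[ℝ] ℝ) ∞ (fun x : M =>
    ((altToBilin (ContinuousAlternatingMap.inCoordinates E ℝ (E₁ := (TangentSpace 𝓘(ℝ, E) : M → Type _)) (E₂ := Bundle.Trivial M ℝ) x₀ x x₀ x (α x))).comp
      (-ContinuousLinearMap.inCoordinates E (TangentSpace 𝓘(ℝ, E) : M → Type _) E (TangentSpace 𝓘(ℝ, E) : M → Type _) x₀ x x₀ x (A x)))) x₀ := by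
    exact contMDiffAt_altToBilin_comp h1 h2
  refine h3.congr_of_eventuallyEq ?_
  have hb := (trivializationAt E (TangentSpace 𝓘(ℝ, E) : M → Type _) x₀).open_baseSet.mem_nhds
    (FiberBundle.mem_baseSet_trivializationAt' x₀)
  filter_upwards [hb] with x hx
  ext v w
  refine (inCoordinates_apply_eq₂ (E₃ := Bundle.Trivial M ℝ) hx hx
    (Set.mem_univ x)).trans ?_
  rw [hg]
  simp [altToBilin_apply]
  change _ = (trivializationAt ℝ (Bundle.Trivial M ℝ) x₀).continuousLinearMapAt ℝ x
    (α x ((trivializationAt E (TangentSpace 𝓘(ℝ, E) : M → Type _) x₀).symmL ℝ x ∘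
      ![(trivializationAt E (TangentSpace 𝓘(ℝ, E) : M → Type _) x₀).continuousLinearMapAt ℝ x
        (A x ((trivializationAt E (TangentSpace 𝓘(ℝ, E) : M → Type _) x₀).symmL ℝ x v)), w]))
  change _ = ((trivializationAt ℝ (Bundle.Trivial M ℝ) x₀).linearMapAt ℝ x) _
  rw [Bundle.Trivialization.linearMapAt_def_of_mem _ (Set.mem_univ x)]
  change _ = α x _
  congr 1
  funext i
  fin_cases i
  · refine (congrArg (A x) (Bundle.Trivialization.symmL_apply (R := ℝ) _ hx v).symm).trans ?_
    exact ((trivializationAt E (TangentSpace 𝓘(ℝ, E) : M → Type _)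
      x₀).symmL_continuousLinearMapAt (R := ℝ) hx _).symm
  · exact (Bundle.Trivialization.symmL_apply _ hx _).symm

/-- A hypercomplex structure on `M`: three smooth integrable almost complex structures `I`, `J`, `K`
with `IJ = -JI = K`. -/
structure HypercomplexStructure (E M : Type*) [NormedAddCommGroup E] [NormedSpace ℝ E]
    [TopologicalSpace M] [ChartedSpace E M] [IsManifold 𝓘(ℝ, E) ∞ M] where
  I : ∀ x : M, TangentSpace 𝓘(ℝ, E) x →L[ℝ] TangentSpace 𝓘(ℝ, E) x
  J : ∀ x : M, TangentSpace 𝓘(ℝ, E) x →L[ℝ] TangentSpace 𝓘(ℝ, E) x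
  K : ∀ x : M, TangentSpace 𝓘(ℝ, E) x →L[ℝ] TangentSpace 𝓘(ℝ, E) x
  I_I : ∀ x X, I x (I x X) = -X
  J_J : ∀ x X, J x (J x X) = -X
  K_K : ∀ x X, K x (K x X) = -X
  I_J : ∀ x X, I x (J x X) = K x X
  J_I : ∀ x X, J x (I x X) = -K x X
  smooth_I : IsSmoothEnd I
  smooth_J : IsSmoothEnd J
  smooth_K : IsSmoothEnd K
  integrable_I : IsIntegrableACS I
  integrable_J : IsIntegrableACS J
  integrable_K : IsIntegrableACS K

namespace HypercomplexStructure

variable (H : HypercomplexStructure E M)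

/-- The quaternionic structure of the tangent space at `x`. -/
def atPoint (x : M) : QuaternionicStructure (TangentSpace 𝓘(ℝ, E) x) where
  I := (H.I x : TangentSpace 𝓘(ℝ, E) x →ₗ[ℝ] TangentSpace 𝓘(ℝ, E) x)
  J := (H.J x : TangentSpace 𝓘(ℝ, E) x →ₗ[ℝ] TangentSpace 𝓘(ℝ, E) x)
  K := (H.K x : TangentSpace 𝓘(ℝ, E) x →ₗ[ℝ] TangentSpace 𝓘(ℝ, E) x)
  I_sq := LinearMap.ext (H.I_I x)
  J_sq := LinearMap.ext (H.J_J x)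
  K_sq := LinearMap.ext (H.K_K x)
  I_mul_J := LinearMap.ext (H.I_J x)
  J_mul_I := LinearMap.ext (H.J_I x)

/-- The Salamon differential `D = η ∘ d`, where `η : Λ^{k+1} → A^{k+1}` is the projection with
kernel `B^{k+1}`. -/
noncomputable def salamonD [hE : FiniteDimensional ℝ E] {k : ℕ}
    (α : ∀ x : M, TangentSpace 𝓘(ℝ, E) x [⋀^Fin k]→L[ℝ] ℂ) (x : M) :
    (H.atPoint x).extremeForms (k + 1) :=
  have : FiniteDimensional ℝ (TangentSpace 𝓘(ℝ, E) x) := hE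
  (H.atPoint x).salamonProj (k + 1) (mextDeriv α x).toAlternatingMap

end HypercomplexStructure

/-- A smooth, possibly indefinite, hyperhermitian metric. -/
structure HyperhermitianMetric {E M : Type*} [NormedAddCommGroup E] [NormedSpace ℝ E]
    [TopologicalSpace M] [ChartedSpace E M] [IsManifold 𝓘(ℝ, E) ∞ M]
    (H : HypercomplexStructure E M) where
  g : ∀ x : M, TangentSpace 𝓘(ℝ, E) x →L[ℝ] TangentSpace 𝓘(ℝ, E) x →L[ℝ] ℝ
  smooth : IsSmoothBilin g
  symm : ∀ x X Y, g x X Y = g x Y X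
  nondegenerate : ∀ x X, (∀ Y, g x X Y = 0) → X = 0
  map_I : ∀ x X Y, g x (H.I x X) (H.I x Y) = g x X Y
  map_J : ∀ x X Y, g x (H.J x X) (H.J x Y) = g x X Y
  map_K : ∀ x X Y, g x (H.K x X) (H.K x Y) = g x X Y

namespace HyperhermitianMetric
variable {H : HypercomplexStructure E M} (G : HyperhermitianMetric H)

theorem apply_self (A : ∀ x : M, TangentSpace 𝓘(ℝ, E) x →L[ℝ] TangentSpace 𝓘(ℝ, E) x)
    (hA : ∀ x X, A x (A x X) = -X) (hg : ∀ x X Y, G.g x (A x X) (A x Y) = G.g x X Y) (x : M)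
    (X : TangentSpace 𝓘(ℝ, E) x) : G.g x (A x X) X = 0 := by
  have h1 := hg x (A x X) X
  rw [hA, map_neg, neg_apply, G.symm x X] at h1
  linarith

/-- The Kähler form `g(A·, ·)` of an almost complex structure `A` that preserves `g`. -/
noncomputable def kahlerForm (A : ∀ x : M, TangentSpace 𝓘(ℝ, E) x →L[ℝ] TangentSpace 𝓘(ℝ, E) x)
    (hA : ∀ x X, A x (A x X) = -X) (hg : ∀ x X Y, G.g x (A x X) (A x Y) = G.g x X Y) (x : M) :
    TangentSpace 𝓘(ℝ, E) x [⋀^Fin 2]→L[ℝ] ℝ :=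
  bilinToAlt (E := E) ((G.g x).comp (A x)) (G.apply_self A hA hg x)

/-- The Kähler form `F_I = g(I·, ·)`. -/
noncomputable def formI := G.kahlerForm H.I H.I_I G.map_I
/-- The Kähler form `F_J = g(J·, ·)`. -/
noncomputable def formJ := G.kahlerForm H.J H.J_J G.map_J
/-- The Kähler form `F_K = g(K·, ·)`. -/
noncomputable def formK := G.kahlerForm H.K H.K_K G.map_K

theorem formI_apply (x : M) (X Y : TangentSpace 𝓘(ℝ, E) x) :
    G.formI x ![X, Y] = G.g x (H.I x X) Y := rfl

/-- The metric is HKT: `I dF_I = J dF_J = K dF_K`, where `(Aβ)(X, Y, Z) = β(AX, AY, AZ)`. -/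
def IsHKT : Prop := ∀ x,
  (mextDeriv G.formI x).compContinuousLinearMap (H.I x) =
      (mextDeriv G.formJ x).compContinuousLinearMap (H.J x) ∧
  (mextDeriv G.formJ x).compContinuousLinearMap (H.J x) =
      (mextDeriv G.formK x).compContinuousLinearMap (H.K x)

end HyperhermitianMetric

/-- A `(1,1)`-form in the sense of Salamon: a smooth real 2-form `F` with `IF = F` and `JF = -F`,
where `(AF)(X, Y) = F(AX, AY)`. -/
structure SalamonForm {E M : Type*} [NormedAddCommGroup E] [NormedSpace ℝ E]
    [TopologicalSpace M] [ChartedSpace E M] [IsManifold 𝓘(ℝ, E) ∞ M]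
    (H : HypercomplexStructure E M) where
  F : ∀ x : M, TangentSpace 𝓘(ℝ, E) x [⋀^Fin 2]→L[ℝ] ℝ
  smooth : IsSmoothForm F
  map_I : ∀ x, (F x).compContinuousLinearMap (H.I x) = F x
  map_J : ∀ x, (F x).compContinuousLinearMap (H.J x) = -F x

namespace SalamonForm
variable {H : HypercomplexStructure E M} (S : SalamonForm H)

/-- `F` is non-degenerate at every point. -/
def Nondegenerate : Prop :=
  ∀ x (X : TangentSpace 𝓘(ℝ, E) x), (∀ Y, S.F x ![X, Y] = 0) → X = 0

/-- The bilinear form `-F(I·, ·)`. -/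
noncomputable def bilin (x : M) : TangentSpace 𝓘(ℝ, E) x →L[ℝ] TangentSpace 𝓘(ℝ, E) x →L[ℝ] ℝ :=
  -((altToBilin (E := E) (S.F x)).comp (H.I x))

/-- The real form `F` as a complex-valued form. -/
noncomputable def complexForm (x : M) : TangentSpace 𝓘(ℝ, E) x [⋀^Fin 2]→L[ℝ] ℂ :=
  Complex.ofRealCLM.compContinuousAlternatingMap (S.F x)

theorem bilin_apply (x : M) (X Y : TangentSpace 𝓘(ℝ, E) x) :
    S.bilin x X Y = -S.F x ![H.I x X, Y] :=
  congrArg Neg.neg (altToBilin_apply (E := E) (S.F x) (H.I x X) Y)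

theorem apply_I (x : M) (X Y : TangentSpace 𝓘(ℝ, E) x) :
    S.F x ![H.I x X, H.I x Y] = S.F x ![X, Y] := by
  have := congrArg (fun f => f ![X, Y]) (S.map_I x)
  refine Eq.trans ?_ this
  rw [ContinuousAlternatingMap.compContinuousLinearMap_apply]
  congr 1
  funext i
  fin_cases i <;> rfl

theorem apply_J (x : M) (X Y : TangentSpace 𝓘(ℝ, E) x) :
    S.F x ![H.J x X, H.J x Y] = -S.F x ![X, Y] := by
  have := congrArg (fun f => f ![X, Y]) (S.map_J x)
  refine Eq.trans ?_ this
  rw [ContinuousAlternatingMap.compContinuousLinearMap_apply]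
  congr 1
  funext i
  fin_cases i <;> rfl

theorem apply_neg_left (x : M) (X Y : TangentSpace 𝓘(ℝ, E) x) :
    S.F x ![-X, Y] = -S.F x ![X, Y] :=
  alternating_neg_left (E := E) (S.F x) X Y

theorem apply_swap (x : M) (X Y : TangentSpace 𝓘(ℝ, E) x) :
    S.F x ![X, Y] = -S.F x ![Y, X] := by
  have := (S.F x).toAlternatingMap.map_swap ![Y, X] (i := 0) (j := 1) (by simp)
  rw [← ContinuousAlternatingMap.coe_toAlternatingMap, ← this]
  congr 1
  funext i
  fin_cases i <;> rfl

theorem bilin_map_J (x : M) (X Y : TangentSpace 𝓘(ℝ, E) x) :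
    S.bilin x (H.J x X) (H.J x Y) = S.bilin x X Y := by
  rw [S.bilin_apply, S.bilin_apply, H.I_J, ← S.apply_neg_left, ← H.J_I, S.apply_J]

/-- The hyperhermitian metric `g = -F(I·, ·)` of a non-degenerate Salamon `(1,1)`-form. -/
noncomputable def metric (hS : S.Nondegenerate) : HyperhermitianMetric H where
  g := S.bilin
  smooth := isSmoothBilin_of_form S.F H.I S.smooth H.smooth_I _ S.bilin_apply
  symm x X Y := by
    rw [S.bilin_apply, S.bilin_apply, ← S.apply_I x (H.I x X), H.I_I, S.apply_neg_left,
      S.apply_swap, neg_neg]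
  nondegenerate x X h := by
    have h1 : H.I x X = 0 := hS x _ fun Y => by simpa [S.bilin_apply] using h Y
    have h2 := H.I_I x X
    rw [h1, map_zero] at h2
    exact neg_eq_zero.1 h2.symm
  map_I x X Y := by
    rw [S.bilin_apply, S.bilin_apply, S.apply_I]
  map_J := S.bilin_map_J
  map_K x X Y := by
    rw [← H.I_J, ← H.I_J, S.bilin_apply, S.apply_I, ← S.bilin_apply, S.bilin_map_J]

end SalamonForm
end

/-!
Whether a three-form is of type `(2, 1) + (1, 2)` for a complex structure `A` is the condition
`α(AX, AY, Z) + α(AX, Y, AZ) + α(X, AY, AZ) = α(X, Y, Z)` (`IsMiddleForm`,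
`mem_iSup_typeForms_three_iff`). If it holds for `I`, `J` and `K`, the cross terms of `aI + bJ + cK`
cancel, so it holds on the whole sphere (`isMiddleForm_of_mem_sphere`). Hence `DF = 0` means that
`dF` is middle for `I`, `J` and `K`.

Integrability enters in two ways. The form `F` is of type `(1, 1)` for `I`, so `dF` is always middle
for `I` (`isMiddleForm_extDeriv`). Moreover `F_I + i F_J` is of type `(2, 0)` for `K`, and
`F_I - i F_K` is of type `(2, 0)` for `J`, so their differentials have no components of type
`(1, 2)` and `(0, 3)` (`isTypeRelated_extDeriv`). A form of this kind is determined by its real part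
(`IsTypeRelated.right_eq`), which expresses `dF_J` (with `A = K`) and `-dF_K` (with `A = J`) as
`-1/2 (dF(A·, ·, ·) + dF(·, A·, ·) + dF(·, ·, A·) + dF(A·, A·, A·))`. On the other hand, the
equations `I dF_I = J dF_J = K dF_K` say that `dF_J = -K dF` and `dF_K = J dF`. Comparing the two,
they hold exactly when the derivation induced by `A` agrees with the pullback by `A` on `dF` for
`A = J, K`, which is middleness of `dF` for `J` and `K` (`hkt_iff_isMiddleForm`).

The differential facts are pointwise consequences of the product rule and of the vanishing of the
Nijenhuis tensor on constant vector fields. They are proved on a vector space and transferred to the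
manifold through the chart at the point, where the coordinate vector fields test integrability
(`isNijenhuisFreeAt_endInChart`).
-/

/-! ### Forms of degree three on a quaternionic vector space -/

section
variable {V W : Type*} [AddCommGroup V] [Module ℝ V] [AddCommGroup W] [Module ℝ W]

/-- A trilinear map in curried, unbundled form. -/
structure IsTrilinear (f : V → V → V → W) : Prop where
  add_left : ∀ X X' Y Z, f (X + X') Y Z = f X Y Z + f X' Y Z
  add_mid : ∀ X Y Y' Z, f X (Y + Y') Z = f X Y Z + f X Y' Z
  add_right : ∀ X Y Z Z', f X Y (Z + Z') = f X Y Z + f X Y Z'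
  smul_left : ∀ (c : ℝ) X Y Z, f (c • X) Y Z = c • f X Y Z
  smul_mid : ∀ (c : ℝ) X Y Z, f X (c • Y) Z = c • f X Y Z
  smul_right : ∀ (c : ℝ) X Y Z, f X Y (c • Z) = c • f X Y Z

theorem IsTrilinear.neg_left {f : V → V → V → W} (hf : IsTrilinear f) (X Y Z : V) :
    f (-X) Y Z = -f X Y Z := by simpa using hf.smul_left (-1) X Y Z

theorem IsTrilinear.neg_mid {f : V → V → V → W} (hf : IsTrilinear f) (X Y Z : V) :
    f X (-Y) Z = -f X Y Z := by simpa using hf.smul_mid (-1) X Y Z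

theorem IsTrilinear.neg_right {f : V → V → V → W} (hf : IsTrilinear f) (X Y Z : V) :
    f X Y (-Z) = -f X Y Z := by simpa using hf.smul_right (-1) X Y Z

theorem AlternatingMap.isTrilinear (φ : V [⋀^Fin 3]→ₗ[ℝ] W) :
    IsTrilinear fun X Y Z => φ ![X, Y, Z] := by
  have u0 : ∀ T X Y Z : V, Function.update ![X, Y, Z] 0 T = ![T, Y, Z] := fun T X Y Z => by
    funext i; fin_cases i <;> rfl
  have u1 : ∀ T X Y Z : V, Function.update ![X, Y, Z] 1 T = ![X, T, Z] := fun T X Y Z => by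
    funext i; fin_cases i <;> rfl
  have u2 : ∀ T X Y Z : V, Function.update ![X, Y, Z] 2 T = ![X, Y, T] := fun T X Y Z => by
    funext i; fin_cases i <;> rfl
  constructor
  · intro X X' Y Z; simpa only [u0] using φ.map_update_add ![X, Y, Z] 0 X X'
  · intro X Y Y' Z; simpa only [u1] using φ.map_update_add ![X, Y, Z] 1 Y Y'
  · intro X Y Z Z'; simpa only [u2] using φ.map_update_add ![X, Y, Z] 2 Z Z'
  · intro c X Y Z; simpa only [u0] using φ.map_update_smul ![X, Y, Z] 0 c X
  · intro c X Y Z; simpa only [u1] using φ.map_update_smul ![X, Y, Z] 1 c Y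
  · intro c X Y Z; simpa only [u2] using φ.map_update_smul ![X, Y, Z] 2 c Z

theorem AlternatingMap.apply_rotate_fin_three (φ : V [⋀^Fin 3]→ₗ[ℝ] W) (X Y Z : V) :
    φ ![X, Y, Z] = φ ![Y, Z, X] := by
  have h1 := φ.map_swap ![X, Y, Z] (i := 0) (j := 1) (by decide)
  have h2 := φ.map_swap ![Y, X, Z] (i := 1) (j := 2) (by decide)
  have e1 : ![X, Y, Z] ∘ Equiv.swap (0 : Fin 3) 1 = ![Y, X, Z] := by
    funext i; fin_cases i <;> rfl
  have e2 : ![Y, X, Z] ∘ Equiv.swap (1 : Fin 3) 2 = ![Y, Z, X] := by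
    funext i; fin_cases i <;> rfl
  rw [e1] at h1
  rw [e2] at h2
  rw [h2, h1, neg_neg]

theorem AlternatingMap.sum_update_fin_three (α : V [⋀^Fin 3]→ₗ[ℝ] ℂ) (A : Module.End ℝ V)
    (X Y Z : V) :
    ∑ j, α (Function.update ![X, Y, Z] j (A (![X, Y, Z] j))) =
      α ![A X, Y, Z] + α ![X, A Y, Z] + α ![X, Y, A Z] := by
  have h0 : Function.update ![X, Y, Z] 0 (A X) = ![A X, Y, Z] := by
    funext i; fin_cases i <;> rfl
  have h1 : Function.update ![X, Y, Z] 1 (A Y) = ![X, A Y, Z] := by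
    funext i; fin_cases i <;> rfl
  have h2 : Function.update ![X, Y, Z] 2 (A Z) = ![X, Y, A Z] := by
    funext i; fin_cases i <;> rfl
  rw [Fin.sum_univ_three]
  simp only [Matrix.cons_val_zero, Matrix.cons_val_one, Matrix.cons_val, h0, h1, h2]

theorem mem_typeForms_three_iff {α : V [⋀^Fin 3]→ₗ[ℝ] ℂ} {A : Module.End ℝ V} {p q : ℕ} :
    α ∈ typeForms A p q ↔ ∀ X Y Z, α ![A X, Y, Z] + α ![X, A Y, Z] + α ![X, Y, A Z] =
      Complex.I * ((p : ℂ) - (q : ℂ)) * α ![X, Y, Z] := by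
  constructor
  · intro h X Y Z
    rw [← AlternatingMap.sum_update_fin_three]
    exact h _
  · intro h v
    have hv : v = ![v 0, v 1, v 2] := by funext i; fin_cases i <;> rfl
    rw [hv, AlternatingMap.sum_update_fin_three]
    exact h _ _ _

/-- The identity `α(AX, AY, Z) + α(AX, Y, AZ) + α(X, AY, AZ) = α(X, Y, Z)`. For a complex structure
`A` the left side is `-3 α` on forms of type `(3, 0)` and `(0, 3)` and `α` on forms of type `(2, 1)`
and `(1, 2)`, so the identity singles out the sum of the latter two types. -/
def IsMiddleForm (A : V → V) (f : V → V → V → W) : Prop :=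
  ∀ X Y Z, f (A X) (A Y) Z + f (A X) Y (A Z) + f X (A Y) (A Z) = f X Y Z

/-- On middle forms the derivation induced by `A` is the pullback by `A`. -/
theorem IsMiddleForm.sum_eq {f : V → V → V → W} (hf : IsTrilinear f) {A : V → V}
    (hA : ∀ X, A (A X) = -X) (h : IsMiddleForm A f) (X Y Z : V) :
    f (A X) Y Z + f X (A Y) Z + f X Y (A Z) = f (A X) (A Y) (A Z) := by
  have := h (A X) Y Z
  simp only [hA, hf.neg_left] at this
  rw [← sub_eq_zero] at this ⊢
  rw [← neg_eq_zero, ← this]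
  abel

theorem isMiddleForm_of_sum_eq {f : V → V → V → W} (hf : IsTrilinear f) {A : V → V}
    (hA : ∀ X, A (A X) = -X)
    (h : ∀ X Y Z, f (A X) Y Z + f X (A Y) Z + f X Y (A Z) = f (A X) (A Y) (A Z)) :
    IsMiddleForm A f := fun X Y Z => by
  have := h (A X) Y Z
  simp only [hA, hf.neg_left] at this
  rw [← sub_eq_zero] at this ⊢
  rw [← this]
  abel

theorem mem_iSup_typeForms_three_iff {α : V [⋀^Fin 3]→ₗ[ℝ] ℂ} {A : Module.End ℝ V}
    (hA : ∀ X, A (A X) = -X) :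
    α ∈ (⨆ (p : ℕ) (q : ℕ) (_ : 0 < p ∧ 0 < q ∧ p + q = 3), typeForms A p q :
      Submodule ℂ (V [⋀^Fin 3]→ₗ[ℝ] ℂ)) ↔ IsMiddleForm A fun X Y Z => α ![X, Y, Z] := by
  have neg0 := fun β : V [⋀^Fin 3]→ₗ[ℝ] ℂ => β.isTrilinear.neg_left
  have neg1 := fun β : V [⋀^Fin 3]→ₗ[ℝ] ℂ => β.isTrilinear.neg_mid
  have neg2 := fun β : V [⋀^Fin 3]→ₗ[ℝ] ℂ => β.isTrilinear.neg_right
  constructor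
  · let S : Submodule ℂ (V [⋀^Fin 3]→ₗ[ℝ] ℂ) :=
      { carrier := {β | IsMiddleForm A fun X Y Z => β ![X, Y, Z]}
        add_mem' := fun {β γ} hβ hγ X Y Z => by
          simp only [AlternatingMap.add_apply]
          linear_combination hβ X Y Z + hγ X Y Z
        zero_mem' := fun X Y Z => by simp
        smul_mem' := fun c β hβ X Y Z => by
          simp only [AlternatingMap.smul_apply, smul_eq_mul]
          linear_combination c * hβ X Y Z }
    intro h
    refine (?_ : _ ≤ S) h
    refine iSup_le fun p => iSup_le fun q => iSup_le fun ⟨hp, hq, hpq⟩ β hβ X Y Z => ?_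
    rw [mem_typeForms_three_iff] at hβ
    have h0 := hβ (A X) Y Z
    have h1 := hβ X (A Y) Z
    have h2 := hβ X Y (A Z)
    have h3 := hβ X Y Z
    simp only [hA, neg0, neg1, neg2] at h0 h1 h2
    have hc : (Complex.I * ((p : ℂ) - (q : ℂ))) ^ 2 = -1 := by
      have hI := Complex.I_sq
      obtain ⟨rfl, rfl⟩ | ⟨rfl, rfl⟩ : (p = 2 ∧ q = 1) ∨ (p = 1 ∧ q = 2) := by omega
      · push_cast; linear_combination hI
      · push_cast; linear_combination hI
    linear_combination (1 / 2 : ℂ) * (h0 + h1 + h2) +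
      (1 / 2 : ℂ) * Complex.I * ((p : ℂ) - (q : ℂ)) * h3 + (1 / 2 : ℂ) * β ![X, Y, Z] * hc
  · intro h
    have hcomp : ∀ X Y Z, α.compLinearMap A ![X, Y, Z] = α ![A X, A Y, A Z] := fun X Y Z => by
      rw [AlternatingMap.compLinearMap_apply]
      congr 1
      funext i
      fin_cases i <;> rfl
    have hD := IsMiddleForm.sum_eq α.isTrilinear hA h
    have hI := Complex.I_sq
    -- The components of `α` of type `(2, 1)` and `(1, 2)`.
    have key : α = (1 / 2 : ℂ) • (α - Complex.I • α.compLinearMap A) +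
        (1 / 2 : ℂ) • (α + Complex.I • α.compLinearMap A) := by module
    rw [key]
    refine add_mem (Submodule.smul_mem _ _ ?_) (Submodule.smul_mem _ _ ?_)
    · refine Submodule.mem_iSup_of_mem 2 (Submodule.mem_iSup_of_mem 1
        (Submodule.mem_iSup_of_mem (by decide) ?_))
      rw [mem_typeForms_three_iff]
      intro X Y Z
      have h0 := hD X Y Z
      have h1 := hD (A X) (A Y) (A Z)
      simp only [hA, neg0, neg1, neg2] at h1
      simp only [AlternatingMap.sub_apply, AlternatingMap.smul_apply, smul_eq_mul, hcomp, hA, neg0,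
        neg1, neg2]
      push_cast
      linear_combination h0 - Complex.I * h1 + α ![A X, A Y, A Z] * hI
    · refine Submodule.mem_iSup_of_mem 1 (Submodule.mem_iSup_of_mem 2
        (Submodule.mem_iSup_of_mem (by decide) ?_))
      rw [mem_typeForms_three_iff]
      intro X Y Z
      have h0 := hD X Y Z
      have h1 := hD (A X) (A Y) (A Z)
      simp only [hA, neg0, neg1, neg2] at h1
      simp only [AlternatingMap.add_apply, AlternatingMap.smul_apply, smul_eq_mul, hcomp, hA, neg0,
        neg1, neg2]
      push_cast
      linear_combination h0 + Complex.I * h1 + α ![A X, A Y, A Z] * hI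

/-- Two anticommuting complex structures contribute no cross terms: on forms that are middle for
both, the induced derivations are the pullbacks by `A` and `B`, and these make the derivations
anticommute as well. -/
theorem IsMiddleForm.cross_eq_zero {f : V → V → V → ℝ} (hf : IsTrilinear f) {A B : V → V}
    (hA : ∀ X, A (A X) = -X) (hB : ∀ X, B (B X) = -X) (hAB : ∀ X, B (A X) = -A (B X))
    (hfA : IsMiddleForm A f) (hfB : IsMiddleForm B f) (X Y Z : V) :
    f (A X) (B Y) Z + f (B X) (A Y) Z + f (A X) Y (B Z) + f (B X) Y (A Z) + f X (A Y) (B Z) +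
      f X (B Y) (A Z) = 0 := by
  have a1 := hfA.sum_eq hf hA (B X) Y Z
  have a2 := hfA.sum_eq hf hA X (B Y) Z
  have a3 := hfA.sum_eq hf hA X Y (B Z)
  have b1 := hfB.sum_eq hf hB (A X) Y Z
  have b2 := hfB.sum_eq hf hB X (A Y) Z
  have b3 := hfB.sum_eq hf hB X Y (A Z)
  have a4 := hfA.sum_eq hf hA (B X) (B Y) (B Z)
  have b4 := hfB.sum_eq hf hB (A X) (A Y) (A Z)
  simp only [hAB, hf.neg_left, hf.neg_mid, hf.neg_right] at *
  linear_combination (1 / 2) * (a1 + a2 + a3 + b1 + b2 + b3) - (1 / 2) * (a4 + b4)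

theorem IsTrilinear.neg {f : V → V → V → ℝ} (hf : IsTrilinear f) :
    IsTrilinear fun X Y Z => -f X Y Z where
  add_left X X' Y Z := by rw [hf.add_left, neg_add]
  add_mid X Y Y' Z := by rw [hf.add_mid, neg_add]
  add_right X Y Z Z' := by rw [hf.add_right, neg_add]
  smul_left c X Y Z := by rw [hf.smul_left, smul_neg]
  smul_mid c X Y Z := by rw [hf.smul_mid, smul_neg]
  smul_right c X Y Z := by rw [hf.smul_right, smul_neg]

/-- The real part of the condition that the complex three-form `f + i g` has no components of
type `(1, 2)` and `(0, 3)` with respect to `A`, i.e. that it vanishes on `(X + iAX, Y + iAY, Z)`. -/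
def IsTypeRelated (A : V → V) (f g : V → V → V → ℝ) : Prop :=
  ∀ X Y Z, f X Y Z - f (A X) (A Y) Z = g (A X) Y Z + g X (A Y) Z

/-- The imaginary part of a form without components of type `(1, 2)` and `(0, 3)` is determined by
its real part. -/
theorem IsTypeRelated.right_eq {A : V → V} {f g : V → V → V → ℝ} (h : IsTypeRelated A f g)
    (hf : IsTrilinear f) (hg : IsTrilinear g) (hA : ∀ X, A (A X) = -X)
    (hfrot : ∀ X Y Z, f X Y Z = f Y Z X) (hgrot : ∀ X Y Z, g X Y Z = g Y Z X) (X Y Z : V) :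
    g X Y Z = -(1 / 2) * (f (A X) Y Z + f X (A Y) Z + f X Y (A Z) + f (A X) (A Y) (A Z)) := by
  have h1 := h (A X) Y Z
  have h2 := h Y Z (A X)
  have h3 := h Z (A X) Y
  rw [← hfrot, ← hfrot (A X), ← hgrot, ← hgrot (A X)] at h2
  rw [hfrot, hfrot (A Z), hgrot, hgrot Z] at h3
  simp only [hA, hf.neg_left, hg.neg_left] at h1 h2 h3
  linear_combination (1 / 2) * (h1 - h2 + h3)

namespace QuaternionicStructure
variable (Q : QuaternionicStructure V)

/-- Being middle for `I`, `J`, `K` suffices for being middle for the whole sphere. -/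
theorem isMiddleForm_of_mem_sphere {f : V → V → V → ℝ} (hf : IsTrilinear f)
    (hI : IsMiddleForm Q.I f) (hJ : IsMiddleForm Q.J f) (hK : IsMiddleForm Q.K f)
    {A : Module.End ℝ V} (hA : A ∈ Q.sphere) : IsMiddleForm A f := by
  obtain ⟨a, b, c, habc, rfl⟩ := hA
  have II : ∀ X, Q.I (Q.I X) = -X := fun X => by simpa using congrArg (· X) Q.I_sq
  have JJ : ∀ X, Q.J (Q.J X) = -X := fun X => by simpa using congrArg (· X) Q.J_sq
  have KK : ∀ X, Q.K (Q.K X) = -X := fun X => by simpa using congrArg (· X) Q.K_sq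
  have IJ : ∀ X, Q.J (Q.I X) = -Q.I (Q.J X) := fun X => by
    simpa using congrArg (· X) (Q.J_mul_I.trans (congrArg Neg.neg Q.I_mul_J.symm))
  have JK : ∀ X, Q.K (Q.J X) = -Q.J (Q.K X) := fun X => by
    simpa using congrArg (· X) (Q.K_mul_J.trans (congrArg Neg.neg Q.J_mul_K.symm))
  have KI : ∀ X, Q.I (Q.K X) = -Q.K (Q.I X) := fun X => by
    simpa using congrArg (· X) (Q.I_mul_K.trans (congrArg Neg.neg Q.K_mul_I.symm))
  intro X Y Z
  have h1 := hI X Y Z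
  have h2 := hJ X Y Z
  have h3 := hK X Y Z
  have h4 := hI.cross_eq_zero hf II JJ IJ hJ X Y Z
  have h5 := hJ.cross_eq_zero hf JJ KK JK hK X Y Z
  have h6 := hK.cross_eq_zero hf KK II KI hI X Y Z
  simp only [LinearMap.add_apply, LinearMap.smul_apply, hf.add_left, hf.add_mid, hf.add_right,
    hf.smul_left, hf.smul_mid, hf.smul_right, smul_eq_mul]
  linear_combination a ^ 2 * h1 + b ^ 2 * h2 + c ^ 2 * h3 + a * b * h4 + b * c * h5 + c * a * h6 +
    f X Y Z * habc

theorem ofReal_mem_middleForms_three_iff {α : V [⋀^Fin 3]→ₗ[ℝ] ℂ} {f : V → V → V → ℝ}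
    (hf : IsTrilinear f) (hα : ∀ X Y Z, α ![X, Y, Z] = f X Y Z) :
    α ∈ Q.middleForms 3 ↔ IsMiddleForm Q.I f ∧ IsMiddleForm Q.J f ∧ IsMiddleForm Q.K f := by
  have key : ∀ A ∈ Q.sphere,
      (α ∈ (⨆ (p : ℕ) (q : ℕ) (_ : 0 < p ∧ 0 < q ∧ p + q = 3), typeForms A p q :
        Submodule ℂ (V [⋀^Fin 3]→ₗ[ℝ] ℂ)) ↔ IsMiddleForm A f) := fun A hA => by
    rw [mem_iSup_typeForms_three_iff fun X => by simpa using congrArg (· X) (Q.sphere_sq hA)]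
    simp only [IsMiddleForm, hα]
    norm_cast
  have hmem : α ∈ Q.middleForms 3 ↔ ∀ A ∈ Q.sphere, IsMiddleForm A f := by
    rw [middleForms, Submodule.mem_iInf]
    refine forall_congr' fun A => ?_
    rw [Submodule.mem_iInf]
    exact forall_congr' fun hA => key A hA
  rw [hmem]
  constructor
  · intro h
    exact ⟨h _ ⟨1, 0, 0, by norm_num, by simp⟩, h _ ⟨0, 1, 0, by norm_num, by simp⟩,
      h _ ⟨0, 0, 1, by norm_num, by simp⟩⟩
  · rintro ⟨hI, hJ, hK⟩ A hA
    exact Q.isMiddleForm_of_mem_sphere hf hI hJ hK hA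

/-- If the differentials `φI`, `φJ`, `φK` of the Kähler forms satisfy the type relations that
integrability of `J` and `K` imposes on them, then the HKT condition says that `φI` is middle for
`J` and `K`. -/
theorem hkt_iff_isMiddleForm {φI φJ φK : V → V → V → ℝ} (hφI : IsTrilinear φI)
    (hφJ : IsTrilinear φJ) (hφK : IsTrilinear φK) (hrotI : ∀ X Y Z, φI X Y Z = φI Y Z X)
    (hrotJ : ∀ X Y Z, φJ X Y Z = φJ Y Z X) (hrotK : ∀ X Y Z, φK X Y Z = φK Y Z X)
    (hIJ : IsTypeRelated Q.K φI φJ)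
    (hIK : IsTypeRelated Q.J φI fun X Y Z => -φK X Y Z) :
    ((∀ X Y Z, φI (Q.I X) (Q.I Y) (Q.I Z) = φJ (Q.J X) (Q.J Y) (Q.J Z)) ∧
      ∀ X Y Z, φJ (Q.J X) (Q.J Y) (Q.J Z) = φK (Q.K X) (Q.K Y) (Q.K Z)) ↔
      IsMiddleForm Q.J φI ∧ IsMiddleForm Q.K φI := by
  have JJ : ∀ X, Q.J (Q.J X) = -X := fun X => by simpa using congrArg (· X) Q.J_sq
  have KK : ∀ X, Q.K (Q.K X) = -X := fun X => by simpa using congrArg (· X) Q.K_sq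
  have IJ : ∀ X, Q.I (Q.J X) = Q.K X := fun X => by simpa using congrArg (· X) Q.I_mul_J
  have IK : ∀ X, Q.I (Q.K X) = -Q.J X := fun X => by simpa using congrArg (· X) Q.I_mul_K
  have JK : ∀ X, Q.J (Q.K X) = Q.I X := fun X => by simpa using congrArg (· X) Q.J_mul_K
  have KJ : ∀ X, Q.K (Q.J X) = -Q.I X := fun X => by simpa using congrArg (· X) Q.K_mul_J
  have eJ := hIJ.right_eq hφI hφJ KK hrotI hrotJ
  have eK := hIK.right_eq hφI hφK.neg JJ hrotI
    (fun X Y Z => congrArg Neg.neg (hrotK X Y Z))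
  constructor
  · rintro ⟨h1, h2⟩
    constructor
    · refine isMiddleForm_of_sum_eq hφI JJ fun X Y Z => ?_
      -- The equation `I φI = K φK`, pulled back by `K`.
      have h3 := (h1 (Q.K X) (Q.K Y) (Q.K Z)).trans (h2 _ _ _)
      simp only [IK, KK, hφI.neg_left, hφI.neg_mid, hφI.neg_right, hφK.neg_left, hφK.neg_mid,
        hφK.neg_right] at h3
      linear_combination 2 * eK X Y Z + 2 * h3
    · refine isMiddleForm_of_sum_eq hφI KK fun X Y Z => ?_
      -- The equation `I φI = J φJ`, pulled back by `J`.
      have h3 := h1 (Q.J X) (Q.J Y) (Q.J Z)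
      simp only [IJ, JJ, hφJ.neg_left, hφJ.neg_mid, hφJ.neg_right] at h3
      linear_combination 2 * eJ X Y Z - 2 * h3
  · rintro ⟨hJ, hK⟩
    have h1 := hJ.sum_eq hφI JJ
    have h2 := hK.sum_eq hφI KK
    have h3 : ∀ X Y Z, φI (Q.I X) (Q.I Y) (Q.I Z) = φJ (Q.J X) (Q.J Y) (Q.J Z) := fun X Y Z => by
      have := h2 (Q.J X) (Q.J Y) (Q.J Z)
      have := eJ (Q.J X) (Q.J Y) (Q.J Z)
      simp only [KJ, hφI.neg_left, hφI.neg_mid, hφI.neg_right] at *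
      linarith
    refine ⟨h3, fun X Y Z => (h3 X Y Z).symm.trans ?_⟩
    have := h1 (Q.K X) (Q.K Y) (Q.K Z)
    have := eK (Q.K X) (Q.K Y) (Q.K Z)
    simp only [JK] at *
    linarith

end QuaternionicStructure
end

/-! ### Exterior derivatives of two-forms on a vector space with an almost complex structure -/

section
variable {E : Type*} [NormedAddCommGroup E] [NormedSpace ℝ E]

theorem extDeriv_two_apply {F : Type*} [NormedAddCommGroup F] [NormedSpace ℝ F]
    (α : E → E [⋀^Fin 2]→L[ℝ] F) (y X Y Z : E) :
    extDeriv α y ![X, Y, Z] = fderiv ℝ α y X ![Y, Z] - fderiv ℝ α y Y ![X, Z] +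
      fderiv ℝ α y Z ![X, Y] := by
  rw [extDeriv, ContinuousAlternatingMap.alternatizeUncurryFin_apply, Fin.sum_univ_three]
  have h0 : Fin.removeNth 0 ![X, Y, Z] = ![Y, Z] := by funext i; fin_cases i <;> rfl
  have h1 : Fin.removeNth 1 ![X, Y, Z] = ![X, Z] := by funext i; fin_cases i <;> rfl
  have h2 : Fin.removeNth 2 ![X, Y, Z] = ![X, Y] := by funext i; fin_cases i <;> rfl
  rw [h0, h1, h2]
  simp [sub_eq_add_neg]

theorem alternating_swap (f : E [⋀^Fin 2]→L[ℝ] ℝ) (v w : E) : f ![v, w] = -f ![w, v] := by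
  have := f.toAlternatingMap.map_swap ![w, v] (i := 0) (j := 1) (by simp)
  rw [← ContinuousAlternatingMap.coe_toAlternatingMap, ← this]
  congr 1
  funext i
  fin_cases i <;> rfl

theorem alternating_zero_left (f : E [⋀^Fin 2]→L[ℝ] ℝ) (w : E) : f ![0, w] = 0 :=
  f.map_coord_zero (i := 0) rfl

theorem alternating_zero_right (f : E [⋀^Fin 2]→L[ℝ] ℝ) (v : E) : f ![v, 0] = 0 :=
  f.map_coord_zero (i := 1) rfl

/-- The Nijenhuis tensor of a field `A` of endomorphisms of a vector space vanishes at `y`. It is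
tested on constant vector fields, whose brackets with fields `A Y` only involve the derivative of
`A`. -/
def IsNijenhuisFreeAt (A : E → E →L[ℝ] E) (y : E) : Prop :=
  ∀ X Y, fderiv ℝ A y (A y X) Y - fderiv ℝ A y (A y Y) X + A y (fderiv ℝ A y Y X) -
    A y (fderiv ℝ A y X Y) = 0

variable {A : E → E →L[ℝ] E} {α β : E → E [⋀^Fin 2]→L[ℝ] ℝ} {y : E}

theorem fderiv_alternating_apply (hα : DifferentiableAt ℝ α y) {B C : E → E}
    {B' C' : E →L[ℝ] E} (hB : HasFDerivAt B B' y) (hC : HasFDerivAt C C' y) (T : E) :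
    fderiv ℝ (fun z => α z ![B z, C z]) y T =
      fderiv ℝ α y T ![B y, C y] + α y ![B' T, C y] + α y ![B y, C' T] := by
  have h := fderiv_continuousAlternatingMap_apply_apply (g := ![B, C]) hα
    (fun i => by fin_cases i; exacts [hB.differentiableAt, hC.differentiableAt]) T
  have e : ∀ z, (fun i => (![B, C] : Fin 2 → E → E) i z) = ![B z, C z] := fun z => by
    funext i; fin_cases i <;> rfl
  have e0 : ∀ U, Function.update ![B y, C y] 0 U = ![U, C y] := fun U => by
    funext i; fin_cases i <;> rfl
  have e1 : ∀ U, Function.update ![B y, C y] 1 U = ![B y, U] := fun U => by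
    funext i; fin_cases i <;> rfl
  simp only [e, Fin.sum_univ_two] at h
  rw [h, e0, e1, add_assoc]
  congr 3
  · exact congrArg (fun L : E →L[ℝ] E => ![L T, C y]) hB.fderiv
  · exact congrArg (fun L : E →L[ℝ] E => ![B y, L T]) hC.fderiv

/-- The derivative of the identity `A² = -1`: the derivatives of `A` anticommute with `A`. -/
theorem fderiv_square_neg (hA : DifferentiableAt ℝ A y)
    (hsq : ∀ᶠ z in nhds y, ∀ X, A z (A z X) = -X)
    (T X : E) : fderiv ℝ A y T (A y X) = -A y (fderiv ℝ A y T X) := by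
  have hX := hA.hasFDerivAt.clm_apply (hasFDerivAt_const X y)
  have h1 := (hA.hasFDerivAt.clm_apply hX).fderiv
  have h2 : fderiv ℝ (fun z => A z (A z X)) y = 0 := by
    rw [Filter.EventuallyEq.fderiv_eq (hsq.mono fun z hz => hz X), fderiv_fun_const]
    rfl
  have h3 := congrArg (· T) (h1.symm.trans h2)
  simp at h3
  exact eq_neg_of_add_eq_zero_right h3

/-- The exterior derivative of a `(1, 1)`-form for an integrable complex structure has no components
of type `(3, 0)` and `(0, 3)`. -/
theorem isMiddleForm_extDeriv (hA : DifferentiableAt ℝ A y) (hα : DifferentiableAt ℝ α y)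
    (hsq : ∀ᶠ z in nhds y, ∀ X, A z (A z X) = -X) (hN : IsNijenhuisFreeAt A y)
    (hinv : ∀ᶠ z in nhds y, ∀ X Y, α z ![A z X, A z Y] = α z ![X, Y]) :
    IsMiddleForm (A y) fun X Y Z => extDeriv α y ![X, Y, Z] := by
  have hd : ∀ T X Y, fderiv ℝ α y T ![A y X, A y Y] + α y ![fderiv ℝ A y T X, A y Y] +
      α y ![A y X, fderiv ℝ A y T Y] = fderiv ℝ α y T ![X, Y] := fun T X Y => by
    have h1 := fderiv_alternating_apply hα (hA.hasFDerivAt.clm_apply (hasFDerivAt_const X y))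
      (hA.hasFDerivAt.clm_apply (hasFDerivAt_const Y y)) T
    have h2 := fderiv_alternating_apply hα (hasFDerivAt_const X y) (hasFDerivAt_const Y y) T
    rw [Filter.EventuallyEq.fderiv_eq (hinv.mono fun z hz => hz X Y), h2] at h1
    simpa [alternating_zero_left, alternating_zero_right] using h1.symm
  have hsq' := hsq.self_of_nhds
  have hinv' := hinv.self_of_nhds
  have hsd := fderiv_square_neg hA hsq
  have nl : ∀ U W, α y ![-U, W] = -α y ![U, W] := alternating_neg_left (α y)
  have nr : ∀ U W, α y ![U, -W] = -α y ![U, W] := fun U W => by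
    rw [alternating_swap, nl, alternating_swap, neg_neg]
  have nrd : ∀ T U W, fderiv ℝ α y T ![U, -W] = -fderiv ℝ α y T ![U, W] := fun T U W => by
    rw [alternating_swap, alternating_neg_left, alternating_swap, neg_neg]
  have hflip : ∀ U W, α y ![A y U, W] = -α y ![U, A y W] := fun U W => by
    rw [← hinv' U, hsq', nr, neg_neg]
  -- The derivative of `α(AX, AY) = α(X, Y)`, and the same with `AY` in place of `Y`.
  have hd' : ∀ T X Y, fderiv ℝ α y T ![A y X, A y Y] + α y ![fderiv ℝ A y T X, A y Y] -
      α y ![fderiv ℝ A y T Y, A y X] = fderiv ℝ α y T ![X, Y] := fun T X Y => by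
    rw [← hd T X Y, alternating_swap (α y) (fderiv ℝ A y T Y)]
    ring
  have hd'' : ∀ T X Y, fderiv ℝ α y T ![A y X, Y] + fderiv ℝ α y T ![X, A y Y] =
      α y ![fderiv ℝ A y T Y, X] - α y ![fderiv ℝ A y T X, Y] := fun T X Y => by
    have := hd' T X (A y Y)
    rw [hsq', nr, nrd, hsd, nl, hinv'] at this
    linear_combination -this
  have hN' : ∀ X Y Z, α y ![fderiv ℝ A y (A y X) Y, Z] - α y ![fderiv ℝ A y (A y Y) X, Z] -
      α y ![fderiv ℝ A y Y X, A y Z] + α y ![fderiv ℝ A y X Y, A y Z] = 0 := fun X Y Z => by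
    have := congrArg (fun U => altToBilin (α y) U Z) (hN X Y)
    simp only [map_add, map_sub, map_zero, add_apply,
      sub_apply, zero_apply, altToBilin_apply, hflip] at this
    linear_combination this
  intro X Y Z
  simp only [extDeriv_two_apply]
  linear_combination hd' X Y Z - hd' Y X Z + hd' Z X Y + hd'' (A y X) Y Z - hd'' (A y Y) X Z +
    hd'' (A y Z) X Y - hN' X Y Z + hN' X Z Y - hN' Y Z X

/-- If `-α(A·, ·)` is alternating, it is the pullback of `-α / 2` by `1 + A`; this form makes its
differentiability evident. -/
theorem differentiableAt_of_eq_neg_comp (hA : DifferentiableAt ℝ A y) (hα : DifferentiableAt ℝ α y)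
    (hsq : ∀ᶠ z in nhds y, ∀ X, A z (A z X) = -X)
    (hβα : ∀ᶠ z in nhds y, ∀ X Y, β z ![X, Y] = -α z ![A z X, Y]) : DifferentiableAt ℝ β y := by
  have h1 : DifferentiableAt ℝ (fun z => (-(1 / 2) : ℝ) •
      (α z).compContinuousLinearMap (ContinuousLinearMap.id ℝ E + A z)) y :=
    (hα.continuousAlternatingMapCompContinuousLinearMap
      ((differentiableAt_const _).fun_add hA)).fun_const_smul _
  refine h1.congr_of_eventuallyEq ?_
  filter_upwards [hsq, hβα] with z hz hβz
  ext v
  have hv : v = ![v 0, v 1] := by funext i; fin_cases i <;> rfl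
  have hv' : (ContinuousLinearMap.id ℝ E + A z) ∘ v = ![v 0 + A z (v 0), v 1 + A z (v 1)] := by
    funext i; fin_cases i <;> rfl
  rw [ContinuousAlternatingMap.smul_apply, ContinuousAlternatingMap.compContinuousLinearMap_apply,
    hv', ← altToBilin_apply, map_add, map_add, add_apply, add_apply]
  simp only [altToBilin_apply]
  rw [hv, hβz]
  have h2 := hβz (v 0) (v 1)
  have h3 := hβz (v 1) (v 0)
  have h4 := hβz (v 0) (A z (v 1))
  have h5 := hβz (A z (v 1)) (v 0)
  rw [hz, alternating_neg_left] at h5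
  rw [alternating_swap] at h3 h5
  rw [alternating_swap (α z) (v 1)] at h5
  rw [alternating_swap (α z) (A z (v 1))] at h3
  simp only [Matrix.cons_val_zero, Matrix.cons_val_one, smul_eq_mul]
  linear_combination (1 / 2) * (h4 + h5) - (1 / 2) * (h2 + h3)

/-- For an integrable `A` and a form `α + i β` of type `(2, 0)`, the exterior derivative has no
components of type `(1, 2)` and `(0, 3)`. -/
theorem isTypeRelated_extDeriv (hA : DifferentiableAt ℝ A y) (hα : DifferentiableAt ℝ α y)
    (hsq : ∀ᶠ z in nhds y, ∀ X, A z (A z X) = -X) (hN : IsNijenhuisFreeAt A y)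
    (hβα : ∀ᶠ z in nhds y, ∀ X Y, β z ![X, Y] = -α z ![A z X, Y]) :
    IsTypeRelated (A y) (fun X Y Z => extDeriv α y ![X, Y, Z])
      fun X Y Z => extDeriv β y ![X, Y, Z] := by
  have hβ := differentiableAt_of_eq_neg_comp hA hα hsq hβα
  have hd : ∀ T X Y, fderiv ℝ β y T ![X, Y] =
      -(fderiv ℝ α y T ![A y X, Y] + α y ![fderiv ℝ A y T X, Y]) := fun T X Y => by
    have h1 := fderiv_alternating_apply hα (hA.hasFDerivAt.clm_apply (hasFDerivAt_const X y))
      (hasFDerivAt_const Y y) T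
    have h2 := fderiv_alternating_apply hβ (hasFDerivAt_const X y) (hasFDerivAt_const Y y) T
    rw [Filter.EventuallyEq.fderiv_eq (hβα.mono fun z hz => hz X Y), fderiv_fun_neg,
      neg_apply, h1] at h2
    simpa [alternating_zero_left, alternating_zero_right] using h2.symm
  have hsq' := hsq.self_of_nhds
  have hβα' := hβα.self_of_nhds
  have hsd := fderiv_square_neg hA hsq
  have nl : ∀ U W, α y ![-U, W] = -α y ![U, W] := alternating_neg_left (α y)
  have hflip : ∀ U W, α y ![A y U, W] = α y ![U, A y W] := fun U W => by
    have h1 := hβα' U W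
    have h2 := hβα' W U
    rw [alternating_swap] at h2
    rw [alternating_swap (α y) U]
    linear_combination h1 + h2
  have hN' : ∀ X Y Z, α y ![fderiv ℝ A y (A y X) Y, Z] - α y ![fderiv ℝ A y (A y Y) X, Z] +
      α y ![fderiv ℝ A y Y X, A y Z] - α y ![fderiv ℝ A y X Y, A y Z] = 0 := fun X Y Z => by
    have := congrArg (fun U => altToBilin (α y) U Z) (hN X Y)
    simp only [map_add, map_sub, map_zero, add_apply,
      sub_apply, zero_apply, altToBilin_apply, hflip] at this
    linear_combination this
  intro X Y Z
  simp only [extDeriv_two_apply, hd, hsq', hsd, nl, hflip, alternating_neg_left]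
  linear_combination hN' X Y Z

end

/-! ### Forms and endomorphism fields in a chart -/

section
variable {E : Type*} [NormedAddCommGroup E] [NormedSpace ℝ E] {M : Type*} [TopologicalSpace M]
  [ChartedSpace E M]

/-- A field of endomorphisms of the tangent bundle, read in the chart at `x₀`. -/
noncomputable def endInChart
    (A : ∀ x : M, TangentSpace 𝓘(ℝ, E) x →L[ℝ] TangentSpace 𝓘(ℝ, E) x) (x₀ : M) (y : E) :
    E →L[ℝ] E :=
  (mfderiv 𝓘(ℝ, E) 𝓘(ℝ, E) (extChartAt 𝓘(ℝ, E) x₀) ((extChartAt 𝓘(ℝ, E) x₀).symm y)).comp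
    ((A ((extChartAt 𝓘(ℝ, E) x₀).symm y)).comp
      (mfderiv 𝓘(ℝ, E) 𝓘(ℝ, E) (extChartAt 𝓘(ℝ, E) x₀).symm y))

theorem formInChart_apply {F : Type*} [NormedAddCommGroup F] [NormedSpace ℝ F]
    (α : ∀ x : M, TangentSpace 𝓘(ℝ, E) x [⋀^Fin 2]→L[ℝ] F) (x₀ : M) (y X Y : E) :
    formInChart α x₀ y ![X, Y] = α ((extChartAt 𝓘(ℝ, E) x₀).symm y)
      ![mfderiv 𝓘(ℝ, E) 𝓘(ℝ, E) (extChartAt 𝓘(ℝ, E) x₀).symm y X,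
        mfderiv 𝓘(ℝ, E) 𝓘(ℝ, E) (extChartAt 𝓘(ℝ, E) x₀).symm y Y] := by
  rw [formInChart]
  refine (ContinuousAlternatingMap.compContinuousLinearMap_apply _ _ _).trans ?_
  congr 1
  funext i
  fin_cases i <;> rfl

theorem mextDeriv_apply {F : Type*} [NormedAddCommGroup F] [NormedSpace ℝ F]
    (α : ∀ x : M, TangentSpace 𝓘(ℝ, E) x [⋀^Fin 2]→L[ℝ] F)
    {x₀ : M} (X Y Z : TangentSpace 𝓘(ℝ, E) x₀) :
    mextDeriv α x₀ ![X, Y, Z] =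
      extDeriv (formInChart α x₀) (extChartAt 𝓘(ℝ, E) x₀ x₀)
        ![mfderiv 𝓘(ℝ, E) 𝓘(ℝ, E) (extChartAt 𝓘(ℝ, E) x₀) x₀ X,
          mfderiv 𝓘(ℝ, E) 𝓘(ℝ, E) (extChartAt 𝓘(ℝ, E) x₀) x₀ Y,
          mfderiv 𝓘(ℝ, E) 𝓘(ℝ, E) (extChartAt 𝓘(ℝ, E) x₀) x₀ Z] := by
  rw [mextDeriv]
  refine (ContinuousAlternatingMap.compContinuousLinearMap_apply _ _ _).trans ?_
  congr 1
  funext i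
  fin_cases i <;> rfl

variable [IsManifold 𝓘(ℝ, E) ∞ M]

theorem mfderiv_symm_mfderiv_extChartAt {x₀ : M} {y : E}
    (hy : y ∈ (extChartAt 𝓘(ℝ, E) x₀).target)
    (v : TangentSpace 𝓘(ℝ, E) ((extChartAt 𝓘(ℝ, E) x₀).symm y)) :
    mfderiv 𝓘(ℝ, E) 𝓘(ℝ, E) (extChartAt 𝓘(ℝ, E) x₀).symm y
      (mfderiv 𝓘(ℝ, E) 𝓘(ℝ, E) (extChartAt 𝓘(ℝ, E) x₀) ((extChartAt 𝓘(ℝ, E) x₀).symm y) v) =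
      v := by
  have : IsManifold 𝓘(ℝ, E) 1 M := IsManifold.of_le (n := ∞) (by simp)
  have h := mfderivWithin_extChartAt_symm_comp_mfderiv_extChartAt hy
  rw [ModelWithCorners.range_eq_univ, mfderivWithin_univ] at h
  exact congrArg (· v) h

theorem mfderiv_mfderiv_symm_extChartAt {x₀ : M} {y : E}
    (hy : y ∈ (extChartAt 𝓘(ℝ, E) x₀).target) (v : E) :
    mfderiv 𝓘(ℝ, E) 𝓘(ℝ, E) (extChartAt 𝓘(ℝ, E) x₀) ((extChartAt 𝓘(ℝ, E) x₀).symm y)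
      (mfderiv 𝓘(ℝ, E) 𝓘(ℝ, E) (extChartAt 𝓘(ℝ, E) x₀).symm y v) = v := by
  have : IsManifold 𝓘(ℝ, E) 1 M := IsManifold.of_le (n := ∞) (by simp)
  have h := mfderiv_extChartAt_comp_mfderivWithin_extChartAt_symm hy
  rw [ModelWithCorners.range_eq_univ, mfderivWithin_univ] at h
  exact congrArg (· v) h

variable {A : ∀ x : M, TangentSpace 𝓘(ℝ, E) x →L[ℝ] TangentSpace 𝓘(ℝ, E) x} {x₀ : M}

theorem mfderiv_symm_endInChart {y : E} (hy : y ∈ (extChartAt 𝓘(ℝ, E) x₀).target) (v : E) :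
    mfderiv 𝓘(ℝ, E) 𝓘(ℝ, E) (extChartAt 𝓘(ℝ, E) x₀).symm y (endInChart A x₀ y v) =
      A _ (mfderiv 𝓘(ℝ, E) 𝓘(ℝ, E) (extChartAt 𝓘(ℝ, E) x₀).symm y v) :=
  mfderiv_symm_mfderiv_extChartAt hy _

theorem endInChart_endInChart (hA : ∀ x X, A x (A x X) = -X) {y : E}
    (hy : y ∈ (extChartAt 𝓘(ℝ, E) x₀).target) (v : E) :
    endInChart A x₀ y (endInChart A x₀ y v) = -v := by
  have h : endInChart A x₀ y (endInChart A x₀ y v) =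
      mfderiv 𝓘(ℝ, E) 𝓘(ℝ, E) (extChartAt 𝓘(ℝ, E) x₀) ((extChartAt 𝓘(ℝ, E) x₀).symm y)
        (A _ (mfderiv 𝓘(ℝ, E) 𝓘(ℝ, E) (extChartAt 𝓘(ℝ, E) x₀).symm y (endInChart A x₀ y v))) :=
    rfl
  rw [h, mfderiv_symm_endInChart hy, hA, map_neg, mfderiv_mfderiv_symm_extChartAt hy]
  rfl

theorem endInChart_mfderiv (X : TangentSpace 𝓘(ℝ, E) x₀) :
    endInChart A x₀ (extChartAt 𝓘(ℝ, E) x₀ x₀)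
      (mfderiv 𝓘(ℝ, E) 𝓘(ℝ, E) (extChartAt 𝓘(ℝ, E) x₀) x₀ X) =
      mfderiv 𝓘(ℝ, E) 𝓘(ℝ, E) (extChartAt 𝓘(ℝ, E) x₀) x₀ (A x₀ X) := by
  have key : ∀ z : M, z = x₀ → ∀ P : E →L[ℝ] TangentSpace 𝓘(ℝ, E) z,
      (∀ v, P (mfderiv 𝓘(ℝ, E) 𝓘(ℝ, E) (extChartAt 𝓘(ℝ, E) x₀) z v) = v) →
      mfderiv 𝓘(ℝ, E) 𝓘(ℝ, E) (extChartAt 𝓘(ℝ, E) x₀) z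
        (A z (P (mfderiv 𝓘(ℝ, E) 𝓘(ℝ, E) (extChartAt 𝓘(ℝ, E) x₀) x₀ X))) =
      mfderiv 𝓘(ℝ, E) 𝓘(ℝ, E) (extChartAt 𝓘(ℝ, E) x₀) x₀ (A x₀ X) := by
    rintro z rfl P hP
    rw [hP]
  exact key _ (extChartAt_to_inv x₀) _
    (mfderiv_symm_mfderiv_extChartAt (mem_extChartAt_target x₀))

theorem differentiableAt_comp_extChartAt_symm {G : Type*} [NormedAddCommGroup G] [NormedSpace ℝ G]
    {f : M → G} (hf : ContMDiffAt 𝓘(ℝ, E) 𝓘(ℝ, G) ∞ f x₀) :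
    DifferentiableAt ℝ (fun y => f ((extChartAt 𝓘(ℝ, E) x₀).symm y))
      (extChartAt 𝓘(ℝ, E) x₀ x₀) := by
  have h1 : ContMDiffAt 𝓘(ℝ, E) 𝓘(ℝ, E) ∞ (extChartAt 𝓘(ℝ, E) x₀).symm
      (extChartAt 𝓘(ℝ, E) x₀ x₀) :=
    (contMDiffOn_extChartAt_symm x₀).contMDiffAt (extChartAt_target_mem_nhds x₀)
  have h2 : ContMDiffAt 𝓘(ℝ, E) 𝓘(ℝ, G) ∞ (f ∘ (extChartAt 𝓘(ℝ, E) x₀).symm)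
      (extChartAt 𝓘(ℝ, E) x₀ x₀) := by
    refine ContMDiffAt.comp _ ?_ h1
    rwa [extChartAt_to_inv]
  exact h2.contDiffAt.differentiableAt (by simp)

theorem differentiableAt_endInChart (hA : IsSmoothEnd A) :
    DifferentiableAt ℝ (endInChart A x₀) (extChartAt 𝓘(ℝ, E) x₀ x₀) := by
  have : IsManifold 𝓘(ℝ, E) 1 M := IsManifold.of_le (n := ∞) (by simp)
  have h1 := differentiableAt_comp_extChartAt_symm ((Bundle.contMDiffAt_section x₀).1 (hA x₀))
  refine h1.congr_of_eventuallyEq ?_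
  filter_upwards [extChartAt_target_mem_nhds (I := 𝓘(ℝ, E)) x₀] with y hy
  have hs : (extChartAt 𝓘(ℝ, E) x₀).symm y ∈ (chartAt E x₀).source := by
    rw [← extChartAt_source 𝓘(ℝ, E)]
    exact (extChartAt 𝓘(ℝ, E) x₀).map_target hy
  change _ = ContinuousLinearMap.inCoordinates E (TangentSpace 𝓘(ℝ, E) : M → Type _) E
    (TangentSpace 𝓘(ℝ, E) : M → Type _) x₀ _ x₀ _ (A _)
  rw [ContinuousLinearMap.inCoordinates,
    TangentBundle.continuousLinearMapAt_trivializationAt hs,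
    TangentBundle.symmL_trivializationAt hs, (extChartAt 𝓘(ℝ, E) x₀).right_inv hy,
    ModelWithCorners.range_eq_univ, mfderivWithin_univ]
  rfl

theorem differentiableAt_formInChart {α : ∀ x : M, TangentSpace 𝓘(ℝ, E) x [⋀^Fin 2]→L[ℝ] ℝ}
    (hα : IsSmoothForm α) :
    DifferentiableAt ℝ (formInChart α x₀) (extChartAt 𝓘(ℝ, E) x₀ x₀) := by
  have : IsManifold 𝓘(ℝ, E) 1 M := IsManifold.of_le (n := ∞) (by simp)
  have h1 := differentiableAt_comp_extChartAt_symm ((Bundle.contMDiffAt_section x₀).1 (hα x₀))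
  refine h1.congr_of_eventuallyEq ?_
  filter_upwards [extChartAt_target_mem_nhds (I := 𝓘(ℝ, E)) x₀] with y hy
  have hs : (extChartAt 𝓘(ℝ, E) x₀).symm y ∈ (chartAt E x₀).source := by
    rw [← extChartAt_source 𝓘(ℝ, E)]
    exact (extChartAt 𝓘(ℝ, E) x₀).map_target hy
  change _ = ContinuousAlternatingMap.inCoordinates E ℝ (E₁ := (TangentSpace 𝓘(ℝ, E) : M → Type _))
    (E₂ := Bundle.Trivial M ℝ) x₀ _ x₀ _ (α _)
  ext v
  change _ = ((trivializationAt ℝ (Bundle.Trivial M ℝ) x₀).linearMapAt ℝ _) _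
  rw [Bundle.Trivialization.linearMapAt_def_of_mem _ (Set.mem_univ _)]
  change _ = α _ ((trivializationAt E (TangentSpace 𝓘(ℝ, E) : M → Type _) x₀).symmL ℝ _ ∘ v)
  rw [TangentBundle.symmL_trivializationAt hs, (extChartAt 𝓘(ℝ, E) x₀).right_inv hy,
    ModelWithCorners.range_eq_univ, mfderivWithin_univ]
  rfl

/-- The Lie bracket of two vector fields, computed from their expressions `v`, `w` in the chart. -/
theorem mfderiv_mlieBracket {V W : ∀ x : M, TangentSpace 𝓘(ℝ, E) x} {v w : E → E}
    (hV : ∀ᶠ y in nhds (extChartAt 𝓘(ℝ, E) x₀ x₀), V ((extChartAt 𝓘(ℝ, E) x₀).symm y) =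
      mfderiv 𝓘(ℝ, E) 𝓘(ℝ, E) (extChartAt 𝓘(ℝ, E) x₀).symm y (v y))
    (hW : ∀ᶠ y in nhds (extChartAt 𝓘(ℝ, E) x₀ x₀), W ((extChartAt 𝓘(ℝ, E) x₀).symm y) =
      mfderiv 𝓘(ℝ, E) 𝓘(ℝ, E) (extChartAt 𝓘(ℝ, E) x₀).symm y (w y)) :
    mfderiv 𝓘(ℝ, E) 𝓘(ℝ, E) (extChartAt 𝓘(ℝ, E) x₀) x₀
      (VectorField.mlieBracket 𝓘(ℝ, E) V W x₀) =
      VectorField.lieBracket ℝ v w (extChartAt 𝓘(ℝ, E) x₀ x₀) := by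
  have : IsManifold 𝓘(ℝ, E) 1 M := IsManifold.of_le (n := ∞) (by simp)
  have hpull : ∀ (U : ∀ x : M, TangentSpace 𝓘(ℝ, E) x) (u : E → E),
      (∀ᶠ y in nhds (extChartAt 𝓘(ℝ, E) x₀ x₀), U ((extChartAt 𝓘(ℝ, E) x₀).symm y) =
        mfderiv 𝓘(ℝ, E) 𝓘(ℝ, E) (extChartAt 𝓘(ℝ, E) x₀).symm y (u y)) →
      (VectorField.mpullbackWithin 𝓘(ℝ, E) 𝓘(ℝ, E) (extChartAt 𝓘(ℝ, E) x₀).symm U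
        (Set.range 𝓘(ℝ, E)) : E → E) =ᶠ[nhds (extChartAt 𝓘(ℝ, E) x₀ x₀)] u := by
    intro U u hU
    filter_upwards [hU, extChartAt_target_mem_nhds (I := 𝓘(ℝ, E)) x₀] with y hy hyt
    have hinv := isInvertible_mfderivWithin_extChartAt_symm hyt
    rw [ModelWithCorners.range_eq_univ, mfderivWithin_univ] at hinv
    refine (VectorField.mpullbackWithin_apply ..).trans ?_
    rw [ModelWithCorners.range_eq_univ, mfderivWithin_univ, hy]
    exact hinv.inverse_apply_self _
  have h1 := (hpull V v hV).lieBracket_vectorField_eq (𝕜 := ℝ) (hpull W w hW)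
  rw [← h1, VectorField.mlieBracket, VectorField.mlieBracketWithin_apply]
  have hinv := isInvertible_mfderiv_extChartAt (I := 𝓘(ℝ, E)) (mem_extChartAt_source x₀)
  refine (hinv.self_apply_inverse _).trans ?_
  rw [ModelWithCorners.range_eq_univ, Set.preimage_univ, Set.univ_inter]
  exact congrFun (VectorField.lieBracketWithin_univ (E := E)) _

/-- Integrability, tested on the coordinate vector fields of the chart at `x₀`. -/
theorem isNijenhuisFreeAt_endInChart (hA : IsSmoothEnd A) (hN : IsIntegrableACS A) :
    IsNijenhuisFreeAt (endInChart A x₀) (extChartAt 𝓘(ℝ, E) x₀ x₀) := by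
  have : IsManifold 𝓘(ℝ, E) 1 M := IsManifold.of_le (n := ∞) (by simp)
  -- The coordinate vector field with constant coefficients `v`.
  let P : E → ∀ z : M, TangentSpace 𝓘(ℝ, E) z := fun v z =>
    (trivializationAt E (TangentSpace 𝓘(ℝ, E) : M → Type _) x₀).symmL ℝ z v
  have hP : ∀ v, IsSmoothField (P v) x₀ := fun v => by
    refine (Bundle.contMDiffAt_section x₀).2 ?_
    refine (contMDiffAt_const (c := v)).congr_of_eventuallyEq ?_
    filter_upwards [(trivializationAt E (TangentSpace 𝓘(ℝ, E) : M → Type _)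
      x₀).open_baseSet.mem_nhds (FiberBundle.mem_baseSet_trivializationAt' x₀)] with z hz
    simp only [P]
    rw [Bundle.Trivialization.symmL_apply _ hz,
      Bundle.Trivialization.apply_mk_symm _ hz]
  have hPc : ∀ v, ∀ᶠ y in nhds (extChartAt 𝓘(ℝ, E) x₀ x₀),
      P v ((extChartAt 𝓘(ℝ, E) x₀).symm y) =
        mfderiv 𝓘(ℝ, E) 𝓘(ℝ, E) (extChartAt 𝓘(ℝ, E) x₀).symm y v := fun v => by
    filter_upwards [extChartAt_target_mem_nhds (I := 𝓘(ℝ, E)) x₀] with y hy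
    have hs : (extChartAt 𝓘(ℝ, E) x₀).symm y ∈ (chartAt E x₀).source := by
      rw [← extChartAt_source 𝓘(ℝ, E)]
      exact (extChartAt 𝓘(ℝ, E) x₀).map_target hy
    have h := TangentBundle.symmL_trivializationAt (I := 𝓘(ℝ, E)) hs
    rw [(extChartAt 𝓘(ℝ, E) x₀).right_inv hy, ModelWithCorners.range_eq_univ,
      mfderivWithin_univ] at h
    exact congrArg (· v) h
  have hAPc : ∀ v, ∀ᶠ y in nhds (extChartAt 𝓘(ℝ, E) x₀ x₀),
      A _ (P v ((extChartAt 𝓘(ℝ, E) x₀).symm y)) =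
        mfderiv 𝓘(ℝ, E) 𝓘(ℝ, E) (extChartAt 𝓘(ℝ, E) x₀).symm y (endInChart A x₀ y v) := fun v => by
    filter_upwards [hPc v, extChartAt_target_mem_nhds (I := 𝓘(ℝ, E)) x₀] with y hy hyt
    rw [mfderiv_symm_endInChart hyt, hy]
  have hd : ∀ v, fderiv ℝ (fun y => endInChart A x₀ y v) (extChartAt 𝓘(ℝ, E) x₀ x₀) =
      (fderiv ℝ (endInChart A x₀) (extChartAt 𝓘(ℝ, E) x₀ x₀)).flip v := fun v => by
    have := ((differentiableAt_endInChart (x₀ := x₀) hA).hasFDerivAt.clm_apply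
      (hasFDerivAt_const v (extChartAt 𝓘(ℝ, E) x₀ x₀))).fderiv
    simpa using this
  intro v w
  have h := congrArg (mfderiv 𝓘(ℝ, E) 𝓘(ℝ, E) (extChartAt 𝓘(ℝ, E) x₀) x₀)
    (hN x₀ (P v) (P w) (hP v) (hP w))
  rw [map_sub, map_sub, map_sub, map_zero, ← endInChart_mfderiv, ← endInChart_mfderiv,
    mfderiv_mlieBracket (hAPc v) (hAPc w), mfderiv_mlieBracket (hAPc v) (hPc w),
    mfderiv_mlieBracket (hPc v) (hAPc w), mfderiv_mlieBracket (hPc v) (hPc w)] at h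
  simp only [VectorField.lieBracket, hd, fderiv_fun_const] at h
  have e : ∀ (T : E →L[ℝ] E) (a b c d : E),
      a - b + T c - T d = a - b - T (0 - c) - T (d - 0) - (0 - 0) := by simp
  exact (e _ _ _ _ _).trans h

end

/-! ### Exterior derivatives of two-forms on the manifold -/

section
variable {E : Type*} [NormedAddCommGroup E] [NormedSpace ℝ E]

theorem ContinuousAlternatingMap.compContinuousLinearMap_eq_iff_fin_three {V : Type*}
    [AddCommGroup V] [Module ℝ V] [TopologicalSpace V] {f g : V [⋀^Fin 3]→L[ℝ] ℝ}
    {A B : V →L[ℝ] V} :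
    f.compContinuousLinearMap A = g.compContinuousLinearMap B ↔
      ∀ X Y Z, f ![A X, A Y, A Z] = g ![B X, B Y, B Z] := by
  have hcomp : ∀ (h : V [⋀^Fin 3]→L[ℝ] ℝ) (C : V →L[ℝ] V) (v : Fin 3 → V),
      h.compContinuousLinearMap C v = h ![C (v 0), C (v 1), C (v 2)] := fun h C v => by
    rw [ContinuousAlternatingMap.compContinuousLinearMap_apply]
    congr 1
    funext i
    fin_cases i <;> rfl
  constructor
  · intro h X Y Z
    exact (hcomp f A ![X, Y, Z]).symm.trans
      ((congrArg (· ![X, Y, Z]) h).trans (hcomp g B ![X, Y, Z]))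
  · intro h
    ext v
    rw [hcomp, hcomp, h]

theorem extDeriv_neg_apply (α : E → E [⋀^Fin 2]→L[ℝ] ℝ) (y X Y Z : E) :
    extDeriv (fun z => -α z) y ![X, Y, Z] = -extDeriv α y ![X, Y, Z] := by
  rw [extDeriv_two_apply, extDeriv_two_apply, fderiv_fun_neg]
  simp only [neg_apply, ContinuousAlternatingMap.neg_apply]
  ring

theorem extDeriv_ofReal_comp {α : E → E [⋀^Fin 2]→L[ℝ] ℝ} {y : E} (hα : DifferentiableAt ℝ α y)
    (X Y Z : E) :
    extDeriv (fun z => Complex.ofRealCLM.compContinuousAlternatingMap (α z)) y ![X, Y, Z] =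
      (extDeriv α y ![X, Y, Z] : ℂ) := by
  have h : fderiv ℝ (fun z => Complex.ofRealCLM.compContinuousAlternatingMap (α z)) y =
      (ContinuousLinearMap.compContinuousAlternatingMapCLM ℝ E ℝ ℂ (Fin 2)
        Complex.ofRealCLM).comp (fderiv ℝ α y) :=
    ((ContinuousLinearMap.compContinuousAlternatingMapCLM ℝ E ℝ ℂ (Fin 2)
      Complex.ofRealCLM).hasFDerivAt.comp y hα.hasFDerivAt).fderiv
  rw [extDeriv_two_apply, extDeriv_two_apply, h]
  simp
end

section
variable {E M : Type*} [NormedAddCommGroup E] [NormedSpace ℝ E] [TopologicalSpace M]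
  [ChartedSpace E M]

theorem mextDeriv_neg_apply (α : ∀ x : M, TangentSpace 𝓘(ℝ, E) x [⋀^Fin 2]→L[ℝ] ℝ) {x : M}
    (X Y Z : TangentSpace 𝓘(ℝ, E) x) :
    mextDeriv (fun x => -α x) x ![X, Y, Z] = -mextDeriv α x ![X, Y, Z] := by
  rw [mextDeriv_apply, mextDeriv_apply]
  exact extDeriv_neg_apply (formInChart α x) _ _ _ _

variable [IsManifold 𝓘(ℝ, E) ∞ M]
  {A : ∀ x : M, TangentSpace 𝓘(ℝ, E) x →L[ℝ] TangentSpace 𝓘(ℝ, E) x}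
  {α β : ∀ x : M, TangentSpace 𝓘(ℝ, E) x [⋀^Fin 2]→L[ℝ] ℝ}

theorem mextDeriv_ofReal_comp (hα : IsSmoothForm α) {x : M} (X Y Z : TangentSpace 𝓘(ℝ, E) x) :
    mextDeriv (fun x => Complex.ofRealCLM.compContinuousAlternatingMap (α x)) x ![X, Y, Z] =
      (mextDeriv α x ![X, Y, Z] : ℂ) := by
  rw [mextDeriv_apply, mextDeriv_apply]
  exact extDeriv_ofReal_comp (differentiableAt_formInChart hα) _ _ _

/-- The manifold version of `isMiddleForm_extDeriv`. -/
theorem isMiddleForm_mextDeriv (hA : ∀ x X, A x (A x X) = -X) (hs : IsSmoothEnd A)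
    (hN : IsIntegrableACS A) (hα : IsSmoothForm α)
    (hinv : ∀ x X Y, α x ![A x X, A x Y] = α x ![X, Y]) (x : M) :
    IsMiddleForm (A x) fun X Y Z => mextDeriv α x ![X, Y, Z] := by
  have ht := extChartAt_target_mem_nhds (I := 𝓘(ℝ, E)) x
  have h := isMiddleForm_extDeriv (differentiableAt_endInChart (x₀ := x) hs)
    (differentiableAt_formInChart hα)
    (by filter_upwards [ht] with y hy using endInChart_endInChart hA hy)
    (isNijenhuisFreeAt_endInChart hs hN)
    (by
      filter_upwards [ht] with y hy X Y
      rw [formInChart_apply, formInChart_apply, mfderiv_symm_endInChart hy,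
        mfderiv_symm_endInChart hy, hinv])
  intro X Y Z
  simp only [mextDeriv_apply, ← endInChart_mfderiv]
  exact h _ _ _

/-- The manifold version of `isTypeRelated_extDeriv`. -/
theorem isTypeRelated_mextDeriv (hA : ∀ x X, A x (A x X) = -X) (hs : IsSmoothEnd A)
    (hN : IsIntegrableACS A) (hα : IsSmoothForm α)
    (hβ : ∀ x X Y, β x ![X, Y] = -α x ![A x X, Y]) (x : M) :
    IsTypeRelated (A x) (fun X Y Z => mextDeriv α x ![X, Y, Z])
      fun X Y Z => mextDeriv β x ![X, Y, Z] := by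
  have ht := extChartAt_target_mem_nhds (I := 𝓘(ℝ, E)) x
  have h := isTypeRelated_extDeriv (β := formInChart β x)
    (differentiableAt_endInChart (x₀ := x) hs) (differentiableAt_formInChart hα)
    (by filter_upwards [ht] with y hy using endInChart_endInChart hA hy)
    (isNijenhuisFreeAt_endInChart hs hN)
    (by
      filter_upwards [ht] with y hy X Y
      rw [formInChart_apply, formInChart_apply, mfderiv_symm_endInChart hy, hβ])
  intro X Y Z
  simp only [mextDeriv_apply, ← endInChart_mfderiv]
  exact h _ _ _

end

/-! ### The Kähler forms of a Salamon form -/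

section
variable {E M : Type*} [NormedAddCommGroup E] [NormedSpace ℝ E]
    [TopologicalSpace M] [ChartedSpace E M] [IsManifold 𝓘(ℝ, E) ∞ M]
    {H : HypercomplexStructure E M}

namespace SalamonForm
variable (S : SalamonForm H)

theorem formI_metric (hS : S.Nondegenerate) : (S.metric hS).formI = S.F := by
  funext x
  ext v
  refine (S.bilin_apply x (H.I x (v 0)) (v 1)).trans ?_
  rw [H.I_I, S.apply_neg_left, neg_neg]
  congr 1
  funext i
  fin_cases i <;> rfl

theorem formJ_metric_apply (hS : S.Nondegenerate) (x : M) (X Y : TangentSpace 𝓘(ℝ, E) x) :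
    (S.metric hS).formJ x ![X, Y] = -S.F x ![H.K x X, Y] := by
  refine (S.bilin_apply x _ _).trans ?_
  rw [← H.I_J]
  rfl

theorem formK_metric_apply (hS : S.Nondegenerate) (x : M) (X Y : TangentSpace 𝓘(ℝ, E) x) :
    (S.metric hS).formK x ![X, Y] = S.F x ![H.J x X, Y] := by
  refine (S.bilin_apply x _ _).trans ?_
  have h : H.I x (H.K x X) = -H.J x X := by rw [← H.I_J, H.I_I]
  change -S.F x ![H.I x (H.K x X), Y] = _
  rw [h, S.apply_neg_left, neg_neg]

end SalamonForm
end

theorem mainTheorem3 {E M : Type*} [NormedAddCommGroup E] [NormedSpace ℝ E] [FiniteDimensional ℝ E]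
    [TopologicalSpace M] [ChartedSpace E M] [IsManifold 𝓘(ℝ, E) ∞ M]
    (H : HypercomplexStructure E M) (S : SalamonForm H) (hS : S.Nondegenerate) :
    (S.metric hS).IsHKT ↔ ∀ x : M, H.salamonD S.complexForm x = 0 := by
  rw [HyperhermitianMetric.IsHKT]
  refine forall_congr' fun x => ?_
  have hI : IsMiddleForm (H.I x) fun X Y Z => mextDeriv S.F x ![X, Y, Z] :=
    isMiddleForm_mextDeriv H.I_I H.smooth_I H.integrable_I S.smooth S.apply_I x
  have hIJ : IsTypeRelated (H.K x) (fun X Y Z => mextDeriv S.F x ![X, Y, Z])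
      fun X Y Z => mextDeriv (S.metric hS).formJ x ![X, Y, Z] :=
    isTypeRelated_mextDeriv H.K_K H.smooth_K H.integrable_K S.smooth (S.formJ_metric_apply hS) x
  have hIK : IsTypeRelated (H.J x) (fun X Y Z => mextDeriv S.F x ![X, Y, Z])
      fun X Y Z => -mextDeriv (S.metric hS).formK x ![X, Y, Z] := by
    simp only [← mextDeriv_neg_apply]
    exact isTypeRelated_mextDeriv H.J_J H.smooth_J H.integrable_J S.smooth
      (fun x X Y => congrArg Neg.neg (S.formK_metric_apply hS x X Y)) x
  have tri := fun f : TangentSpace 𝓘(ℝ, E) x [⋀^Fin 3]→L[ℝ] ℝ => f.toAlternatingMap.isTrilinear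
  have rot := fun f : TangentSpace 𝓘(ℝ, E) x [⋀^Fin 3]→L[ℝ] ℝ =>
    f.toAlternatingMap.apply_rotate_fin_three
  have hkt := (H.atPoint x).hkt_iff_isMiddleForm (tri (mextDeriv S.F x))
    (tri (mextDeriv (S.metric hS).formJ x)) (tri (mextDeriv (S.metric hS).formK x))
    (rot _) (rot _) (rot _) hIJ hIK
  have : FiniteDimensional ℝ (TangentSpace 𝓘(ℝ, E) x) := inferInstanceAs (FiniteDimensional ℝ E)
  have hD : H.salamonD S.complexForm x = 0 ↔
      (mextDeriv S.complexForm x).toAlternatingMap ∈ (H.atPoint x).middleForms 3 :=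
    Submodule.projectionOnto_apply_eq_zero_iff _
  rw [hD, (H.atPoint x).ofReal_mem_middleForms_three_iff (tri (mextDeriv S.F x))
    (mextDeriv_ofReal_comp S.smooth), S.formI_metric hS]
  refine (and_congr ContinuousAlternatingMap.compContinuousLinearMap_eq_iff_fin_three
    ContinuousAlternatingMap.compContinuousLinearMap_eq_iff_fin_three).trans (hkt.trans ?_)
  exact ⟨fun h => ⟨hI, h⟩, fun h => h.2⟩
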